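/- Setting. A map $f:\mathbb C\to\mathbb{C}P^2$ is a conformally parametrized minimal Lagrangian immersion with metric $2e^{u}\,dz\,d\bar z$ and Hopf differential $\Psi\,dz^3$ if it has a smooth lift $F:\mathbb C\to S^5\subset\mathbb C^3$ which is horizontal, $F_z\cdot\bar F=F_{\bar z}\cdot\bar F=0$, conformal, $F_z\cdot\overline{F_z}=F_{\bar z}\cdot\overline{F_{\bar z}}=e^u$, $F_z\cdot\overline{F_{\bar z}}=0$, with $F_{z\bar z}\in\mathbb C F$ (minimality) and $\Psi=F_{zz}\cdot\overline{F_{\bar z}}$. For $\lambda\in S^1$, the member $f(\cdot,\lambda)$ of the associated family with data $(u,\psi)$ is the minimal Lagrangian immersion with metric $2e^u\,dz\,d\bar z$ and Hopf differential $-i\lambda^{-3}\psi\,dz^3$ (unique up to isometry). The immersion $f$ is translationally equivariant if $f(t+z)=R(t)f(z)$ for all $t\in\mathbb R$, $z\in\mathbb C$ and some one-parameter subgroup $R$ of $SU(3)$; then $u$ depends only on $y=\operatorname{Im}z$ and $\psi$ is constant. We call $f$ an equivariant cylinder relative to the translation by $\omega$ if $\omega\ne0$ and $f(z+\omega)=f(z)$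 for all $z$. Fix $\lambda_0\in S^1$ and let $f(\cdot,\lambda_0):\mathbb C\to\mathbb{C}P^2$ be a member of an associated family with data $(u,\psi)$ which is translationally equivariant, with $\psi\not\equiv0$. Write $a_1=e^{u(0)}$, $\beta=2a_1+|\psi|^2/a_1^2$, $h=\frac{\beta}{2}-a_1$, $a_2=\frac12\bigl(h+\sqrt{h^2+4a_1h}\bigr)$, $a_3=\frac12\bigl(-h+\sqrt{h^2+4a_1h}\bigr)$, and assume the normalization $u'(0)=0$ and $a_2<a_1$ (the surface is not flat, and the origin is a maximum of the metric factor). Let $k^2=\frac{a_1-a_2}{a_1+a_3}$, $r=\sqrt{2(a_1+a_3)}$, $K=\int_0^{\pi/2}\frac{d\alpha}{\sqrt{1-k^2\sin^2\alpha}}$ and $T=K/r$, so that $2T$ is the period of $u(y)$. Let $id_1,id_2,id_3$ $(d_j\in\mathbb R)$ be the eigenvalues, with multiplicity and in any order, of $$D(\lambda_0)=\begin{pmatrix}0&-i\lambda_0\bar\psi a_1^{-1}&i\lambda_0^{-1}a_1^{1/2}\\-i\lambda_0^{-1}\psi a_1^{-1}&0&i\lambda_0a_1^{1/2}\\i\lambda_0a_1^{1/2}&i\lambda_0^{-1}a_1^{1/2}&0\end{pmatrix},$$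 and put $$\beta_1(y)=\int_0^y\frac{2i\lambda_0^3\bar\psi-iu'e^u}{\lambda_0^3\bar\psi-\lambda_0^{-3}\psi-e^uu'}\,ds,\qquad \beta_2(y)=\int_0^y\frac{2e^u}{\lambda_0^3\bar\psi-\lambda_0^{-3}\psi-e^uu'}\,ds .$$ Claim. (1) Real translations: if $d_2\neq0$, then $f(\cdot,\lambda_0)$ is an equivariant cylinder relative to some real translation $\omega=p$, $p\in\mathbb R\setminus\{0\}$, if and only if $d_1/d_2$ is rational. (2) Purely imaginary translations: $f(\cdot,\lambda_0)$ is an equivariant cylinder relative to some translation $\omega=m\cdot2Ti$, $m\in\mathbb Z\setminus\{0\}$, if and only if there are rational numbers $r_1,r_2$ with $$\operatorname{Re}\beta_1(2T)\,d_j+\operatorname{Im}\beta_2(2T)\Bigl(-d_j^2+\frac{2\beta}{3}\Bigr)=2\pi r_j\qquad(j=1,2).$$ Here, if $\lambda_0^{-3}\psi$ is not real, the integrals $\beta_1(2T)$ and $\beta_2(2T)$ converge absolutely. If $\lambda_0^{-3}\psi$ is real, their common denominator $N(s)$ has zeros and they are read as Cauchy principal values, i.e. as the limits for $\varepsilon\to0^+$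 of the integrals over $\{s\in(0,2T]:|N(s)|>\varepsilon\}$; these limits exist. -/

import Mathlib

open Complex MeasureTheory Filter Topology Polynomial
open scoped LinearAlgebra.Projectivization Matrix ContDiff

namespace MinLag

/-- The complex projective plane, as the space of complex lines in `ℂ³`. -/
abbrev CP2 : Type := ℙ ℂ (Fin 3 → ℂ)

/-- The Hermitian product `Z · W̄ = ∑ₖ zₖ w̄ₖ` on `ℂ³`. -/
def herm (Z W : Fin 3 → ℂ) : ℂ := ∑ k, Z k * (starRingEnd ℂ) (W k)

/-- The Wirtinger derivative `F_z = (F_x - i F_y) / 2`. -/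
noncomputable def dz (F : ℂ → Fin 3 → ℂ) (z : ℂ) : Fin 3 → ℂ :=
  (1 / 2 : ℂ) • (fderiv ℝ F z 1 - I • fderiv ℝ F z I)

/-- The Wirtinger derivative `F_z̄ = (F_x + i F_y) / 2`. -/
noncomputable def dzbar (F : ℂ → Fin 3 → ℂ) (z : ℂ) : Fin 3 → ℂ :=
  (1 / 2 : ℂ) • (fderiv ℝ F z 1 + I • fderiv ℝ F z I)

/-- `F : ℂ → S⁵ ⊆ ℂ³` is a smooth horizontal lift of `f : ℂ → ℂP²` for the Hopf fibration. -/
structure IsHorizontalLift (F : ℂ → Fin 3 → ℂ) (f : ℂ → CP2) : Prop where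
  smooth : ContDiff ℝ ∞ F
  norm_one : ∀ z, herm (F z) (F z) = 1
  lifts : ∀ z, ∃ h : F z ≠ 0, f z = Projectivization.mk ℂ (F z) h
  horizontal : ∀ z, herm (dz F z) (F z) = 0
  horizontal' : ∀ z, herm (dzbar F z) (F z) = 0

/-- `f : ℂ → ℂP²` is a conformally parametrized minimal Lagrangian immersion with induced metric
`2 e^u dz dz̄` and Hopf differential `Ψ dz³`.

A map from the simply connected domain `ℂ` is Lagrangian exactly when it has a horizontal lift `F`
to `S⁵`. The Hopf fibration is a Riemannian submersion, so the metric of `f` is read off from `F`,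
and the mean curvature vector of the conformal immersion `f` is, up to a positive factor, the
projection of the component of `F_{z z̄}` orthogonal to `ℂ F`; hence minimality says that
`F_{z z̄}` is a multiple of `F`. -/
def IsMinimalLagrangian (f : ℂ → CP2) (u : ℂ → ℝ) (Ψ : ℂ → ℂ) : Prop :=
  ∃ F : ℂ → Fin 3 → ℂ, IsHorizontalLift F f ∧
    (∀ z, herm (dz F z) (dz F z) = (Real.exp (u z) : ℂ)) ∧
    (∀ z, herm (dzbar F z) (dzbar F z) = (Real.exp (u z) : ℂ)) ∧
    (∀ z, herm (dz F z) (dzbar F z) = 0) ∧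
    (∀ z, ∃ c : ℂ, dzbar (dz F) z = c • F z) ∧
    (∀ z, Ψ z = herm (dz (dz F) z) (dzbar F z))

/-- `f` is the member at the spectral parameter `lam ∈ S¹` of the associated family with metric
`2 e^u dz dz̄` and cubic differential `ψ dz³`: the minimal Lagrangian immersion with the same metric
and with Hopf differential `ν ψ dz³`, where `i lam³ ν = 1`. -/
def IsAssociatedMember (lam : Circle) (u : ℂ → ℝ) (ψ : ℂ → ℂ) (f : ℂ → CP2) : Prop :=
  IsMinimalLagrangian f u (fun z => -I * (lam : ℂ) ^ (-3 : ℤ) * ψ z)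

theorem toLin'_injective (A : Matrix.specialUnitaryGroup (Fin 3) ℂ) :
    Function.Injective (Matrix.toLin' (A : Matrix (Fin 3) (Fin 3) ℂ)) := by
  have h : star (A : Matrix (Fin 3) (Fin 3) ℂ) * (A : Matrix (Fin 3) (Fin 3) ℂ) = 1 :=
    (Matrix.mem_unitaryGroup_iff').1 (Matrix.mem_specialUnitaryGroup_iff.1 A.2).1
  intro v w hvw
  have h2 := congrArg (fun x => star (A : Matrix (Fin 3) (Fin 3) ℂ) *ᵥ x) hvw
  simpa [Matrix.toLin'_apply, Matrix.mulVec_mulVec, h] using h2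

/-- The isometry of `ℂP²` induced by an element of `SU(3)`. -/
noncomputable def su3Act (A : Matrix.specialUnitaryGroup (Fin 3) ℂ) : CP2 → CP2 :=
  Projectivization.map (Matrix.toLin' (A : Matrix (Fin 3) (Fin 3) ℂ)) (toLin'_injective A)

/-- `f(t + z) = R(t) f(z)` for a (continuous) one-parameter subgroup `R` of `SU(3)`. -/
def IsTranslationallyEquivariant (f : ℂ → CP2) : Prop :=
  ∃ R : Multiplicative ℝ →* Matrix.specialUnitaryGroup (Fin 3) ℂ,
    Continuous (fun t : ℝ => R (Multiplicative.ofAdd t)) ∧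
    ∀ (t : ℝ) (z : ℂ), f (t + z) = su3Act (R (Multiplicative.ofAdd t)) (f z)

/-- `f` is a cylinder relative to the (nontrivial) translation by `w`. -/
def IsCylinderRel (f : ℂ → CP2) (w : ℂ) : Prop :=
  w ≠ 0 ∧ ∀ z, f (z + w) = f z

/-- The potential matrix `D(lam) = 𝔽⁻¹ 𝔽_x |_{z = 0}`, where `𝔽(z, lam)` is the extended frame of
the associated family, with `a₁ = e^{u(0)}` and `u'(0) = 0`. -/
noncomputable def potential (a₁ : ℝ) (ψ lam : ℂ) : Matrix (Fin 3) (Fin 3) ℂ :=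
  !![0, -I * lam * (starRingEnd ℂ) ψ * (a₁ : ℂ)⁻¹, I * lam⁻¹ * (√a₁ : ℂ);
     -I * lam⁻¹ * ψ * (a₁ : ℂ)⁻¹, 0, I * lam * (√a₁ : ℂ);
     I * lam * (√a₁ : ℂ), I * lam⁻¹ * (√a₁ : ℂ), 0]

/-- `β = 2 a₁ + |ψ|² / a₁²`. -/
noncomputable def betaConst (a₁ : ℝ) (ψ : ℂ) : ℝ := 2 * a₁ + ‖ψ‖ ^ 2 / a₁ ^ 2

/-- `a₂`: besides `a₁`, the positive root `w` of `2 w³ - β w² + |ψ|² = 0`. -/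
noncomputable def aTwo (a₁ : ℝ) (ψ : ℂ) : ℝ :=
  ((betaConst a₁ ψ / 2 - a₁) +
    √((betaConst a₁ ψ / 2 - a₁) ^ 2 + 4 * a₁ * (betaConst a₁ ψ / 2 - a₁))) / 2

/-- `a₃`: minus the negative root `w` of `2 w³ - β w² + |ψ|² = 0`. -/
noncomputable def aThree (a₁ : ℝ) (ψ : ℂ) : ℝ :=
  (-(betaConst a₁ ψ / 2 - a₁) +
    √((betaConst a₁ ψ / 2 - a₁) ^ 2 + 4 * a₁ * (betaConst a₁ ψ / 2 - a₁))) / 2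

/-- The elliptic integral of the first kind `J(θ, k)`, as a function of `θ` and of `m = k²`. -/
noncomputable def ellipticJ (θ m : ℝ) : ℝ := ∫ α in (0 : ℝ)..θ, 1 / √(1 - m * Real.sin α ^ 2)

/-- `T = K / r`, where `K = J(π/2, k)` with `k² = (a₁ - a₂) / (a₁ + a₃)` and
`r = √(2 (a₁ + a₃))`; the metric has period `2 T` in `y`. -/
noncomputable def halfPeriod (a₁ : ℝ) (ψ : ℂ) : ℝ :=
  ellipticJ (Real.pi / 2) ((a₁ - aTwo a₁ ψ) / (a₁ + aThree a₁ ψ)) / √(2 * (a₁ + aThree a₁ ψ))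

/-- The common denominator `lam³ ψ̄ - lam⁻³ ψ - e^v v'` of the integrands of `β₁` and `β₂`, for a
function `v` of `y`. -/
noncomputable def betaDen (v : ℝ → ℝ) (ψ lam : ℂ) (s : ℝ) : ℂ :=
  lam ^ 3 * (starRingEnd ℂ) ψ - lam ^ (-3 : ℤ) * ψ - (Real.exp (v s) * deriv v s : ℝ)

/-- The integrand of `β₁`. -/
noncomputable def betaOneIntegrand (v : ℝ → ℝ) (ψ lam : ℂ) (s : ℝ) : ℂ :=
  (2 * I * lam ^ 3 * (starRingEnd ℂ) ψ - I * (deriv v s * Real.exp (v s) : ℝ)) / betaDen v ψ lam s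

/-- The integrand of `β₂`. -/
noncomputable def betaTwoIntegrand (v : ℝ → ℝ) (ψ lam : ℂ) (s : ℝ) : ℂ :=
  (2 * Real.exp (v s) : ℝ) / betaDen v ψ lam s

/-- `β₁(y, lam)`. -/
noncomputable def betaOne (v : ℝ → ℝ) (ψ lam : ℂ) (y : ℝ) : ℂ :=
  ∫ s in (0 : ℝ)..y, betaOneIntegrand v ψ lam s

/-- `β₂(y, lam)`. -/
noncomputable def betaTwo (v : ℝ → ℝ) (ψ lam : ℂ) (y : ℝ) : ℂ :=
  ∫ s in (0 : ℝ)..y, betaTwoIntegrand v ψ lam s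

/-- `B` is the Cauchy principal value of `∫₀^y g(s) ds`, where `g` is singular at the zeros of
`den`: the limit, as `ε → 0⁺`, of the integrals over `{s ∈ (0, y] : |den s| > ε}`. -/
def HasPrincipalValue (g den : ℝ → ℂ) (y : ℝ) (B : ℂ) : Prop :=
  Tendsto (fun ε : ℝ => ∫ s in {s : ℝ | s ∈ Set.Ioc 0 y ∧ ε < ‖den s‖}, g s) (𝓝[>] 0) (𝓝 B)

/-- `Re(B₁) d + Im(B₂) (-d² + 2β/3)` is a rational multiple of `2π`. -/
def ImagPeriodCondition (β : ℝ) (B₁ B₂ : ℂ) (d : ℝ) : Prop :=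
  ∃ r : ℚ, B₁.re * d + B₂.im * (-d ^ 2 + 2 * β / 3) = 2 * Real.pi * r

end MinLag

/-! Translational equivariance makes the horizontal lift `F` move along the
real axis by a one-parameter group, whose generator has the characteristic polynomial of `D(λ₀)`.
Its eigenvalues are distinct because the surface is not flat, so there are coordinates
`g_j = L_j ∘ F` of `F`, the modes, with `g_j (t + z) = exp (i d_j t) g_j z`. A translation closes
up in `ℂP²` exactly when the three multipliers agree, which settles the real translations.

Along the imaginary axis a mode solves a linear second-order equation with `2T`-periodic
coefficients, because `e^u` is even and `2T`-periodic by its elliptic first integral. Combining this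
equation with the structure equations gives a first-order one `g_j' = ρ_j g_j` wherever the common
denominator of `β₁'` and `β₂'` does not vanish. If `λ₀⁻³ ψ` is not real, this holds everywhere and
the multiplier of `2Ti` is `exp ∫ ρ_j`, a number of modulus one whose argument is the left-hand side
of the period condition up to a term independent of `j`. If `λ₀⁻³ ψ` is real, `ρ_j` is real, so the
multipliers are `± 1` and the translation by `4Ti` always closes up; the reflection `y ↦ 2T - y`
then shows that the principal values are `0` for `β₂` and purely imaginary for `β₁`, so that the
period condition reads `0 = 2 π r_j`. -/

namespace MinLag

theorem eq_zero_of_linear_second_order {E : Type*} [NormedAddCommGroup E] [NormedSpace ℝ E]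
    {c : ℝ → ℝ} (hc : Continuous c) {g g' : ℝ → E} (hg : ∀ y, HasDerivAt g (g' y) y)
    (hg' : ∀ y, HasDerivAt g' (c y • g y) y) {y₀ : ℝ} (h0 : g y₀ = 0) (h0' : g' y₀ = 0) :
    g = 0 := by
  funext y
  obtain ⟨R, hy₀, hy⟩ : ∃ R : ℝ, y₀ ∈ Set.Ioo (-R) R ∧ y ∈ Set.Ioo (-R) R :=
    ⟨|y₀| + |y| + 1, abs_lt.1 (by linarith [abs_nonneg y]), abs_lt.1 (by linarith [abs_nonneg y₀])⟩
  obtain ⟨K, hK⟩ := (isCompact_Icc (a := -R) (b := R)).exists_bound_of_continuousOn hc.continuousOn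
  have hlip : ∀ t ∈ Set.Ioo (-R) R,
      LipschitzOnWith (max 1 K).toNNReal (fun p : E × E => (p.2, c t • p.1)) Set.univ := by
    intro t ht
    refine LipschitzOnWith.of_dist_le_mul fun p _ q _ => ?_
    rw [Real.coe_toNNReal _ (by positivity)]
    have hKt : ‖c t‖ ≤ max 1 K := (hK t (Set.Ioo_subset_Icc_self ht)).trans (le_max_right _ _)
    have hsnd : dist p.2 q.2 ≤ max 1 K * dist p q :=
      (le_max_right (dist p.1 q.1) _).trans
        (le_mul_of_one_le_left (dist_nonneg (x := p)) (le_max_left _ _))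
    have hfst : dist (c t • p.1) (c t • q.1) ≤ max 1 K * dist p q := by
      rw [dist_smul₀]
      gcongr
      exact le_max_left _ _
    exact max_le hsnd hfst
  have hsol : Set.EqOn (fun t => (g t, g' t)) 0 (Set.Ioo (-R) R) :=
    ODE_solution_unique_of_mem_Ioo hlip hy₀ (fun t _ => ⟨(hg t).prodMk (hg' t), trivial⟩)
      (fun t _ => ⟨(hasDerivAt_const t 0).congr_deriv (by ext <;> simp), trivial⟩)
      (Prod.ext h0 h0')
  exact congrArg Prod.fst (hsol hy)

section Elliptic

variable {m : ℝ}

theorem one_sub_mul_sin_sq_pos (hm : m < 1) (θ : ℝ) : 0 < 1 - m * Real.sin θ ^ 2 := by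
  rcases eq_or_ne (Real.sin θ) 0 with hs | hs
  · simp [hs]
  · nlinarith [Real.sin_sq_le_one θ, sq_pos_of_ne_zero hs]

theorem one_div_sqrt_one_sub_mul_sin_sq_pos (hm : m < 1) (θ : ℝ) :
    0 < 1 / √(1 - m * Real.sin θ ^ 2) :=
  one_div_pos.2 (Real.sqrt_pos.2 (one_sub_mul_sin_sq_pos hm θ))

theorem continuous_one_div_sqrt_one_sub_mul_sin_sq (hm : m < 1) :
    Continuous fun θ : ℝ => 1 / √(1 - m * Real.sin θ ^ 2) :=
  continuous_const.div (by fun_prop) fun θ => (Real.sqrt_pos.2 (one_sub_mul_sin_sq_pos hm θ)).ne'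

theorem periodic_one_div_sqrt_one_sub_mul_sin_sq (m : ℝ) :
    Function.Periodic (fun θ : ℝ => 1 / √(1 - m * Real.sin θ ^ 2)) Real.pi := fun θ => by
  simp only [Real.sin_add_pi, neg_sq]

theorem hasDerivAt_ellipticJ (hm : m < 1) (θ : ℝ) :
    HasDerivAt (fun t => ellipticJ t m) (1 / √(1 - m * Real.sin θ ^ 2)) θ :=
  ((continuous_one_div_sqrt_one_sub_mul_sin_sq hm).integral_hasStrictDerivAt 0 θ).hasDerivAt

@[simp] theorem ellipticJ_zero (m : ℝ) : ellipticJ 0 m = 0 := by simp [ellipticJ]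

theorem strictMono_ellipticJ (hm : m < 1) : StrictMono fun t => ellipticJ t m :=
  strictMono_of_hasDerivAt_pos (hasDerivAt_ellipticJ hm) (one_div_sqrt_one_sub_mul_sin_sq_pos hm)

theorem ellipticJ_pos (hm : m < 1) {θ : ℝ} (hθ : 0 < θ) : 0 < ellipticJ θ m := by
  simpa using strictMono_ellipticJ hm hθ

theorem surjective_ellipticJ (hm : m < 1) : Function.Surjective fun t => ellipticJ t m := by
  have hint := (continuous_one_div_sqrt_one_sub_mul_sin_sq hm).intervalIntegrable
    (μ := volume) 0 Real.pi
  have hper := periodic_one_div_sqrt_one_sub_mul_sin_sq m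
  have hpos := one_div_sqrt_one_sub_mul_sin_sq_pos hm
  exact (continuous_iff_continuousAt.2 fun t => (hasDerivAt_ellipticJ hm t).continuousAt).surjective
    (hper.tendsto_atTop_intervalIntegral_of_pos' hint hpos Real.pi_pos)
    (hper.tendsto_atBot_intervalIntegral_of_pos' hint hpos Real.pi_pos)

theorem ellipticJ_pi (hm : m < 1) : ellipticJ Real.pi m = 2 * ellipticJ (Real.pi / 2) m := by
  have hint := (continuous_one_div_sqrt_one_sub_mul_sin_sq hm).intervalIntegrable
    (μ := volume)
  have hrefl := intervalIntegral.integral_comp_sub_left (a := 0) (b := Real.pi / 2)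
    (fun θ : ℝ => 1 / √(1 - m * Real.sin θ ^ 2)) Real.pi
  simp only [Real.sin_pi_sub, sub_zero, sub_half] at hrefl
  rw [ellipticJ, ← intervalIntegral.integral_add_adjacent_intervals (hint 0 (Real.pi / 2))
    (hint _ _), ← hrefl, ellipticJ, two_mul]

theorem ellipticJ_add_pi (hm : m < 1) (θ : ℝ) :
    ellipticJ (θ + Real.pi) m = ellipticJ θ m + 2 * ellipticJ (Real.pi / 2) m := by
  have hint := (continuous_one_div_sqrt_one_sub_mul_sin_sq hm).intervalIntegrable
    (μ := volume)
  have hper := (periodic_one_div_sqrt_one_sub_mul_sin_sq m).intervalIntegral_add_eq θ 0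
  rw [zero_add] at hper
  rw [← ellipticJ_pi hm, ellipticJ, ellipticJ, ellipticJ, ← hper,
    intervalIntegral.integral_add_adjacent_intervals (hint _ _) (hint _ _)]

theorem exists_jacobi_amplitude (hm : m < 1) :
    ∃ φ : ℝ → ℝ, φ 0 = 0 ∧ (∀ y, HasDerivAt φ (√(1 - m * Real.sin (φ y) ^ 2)) y) ∧
      ∀ y, φ (y + 2 * ellipticJ (Real.pi / 2) m) = φ y + Real.pi := by
  let J := StrictMono.orderIsoOfSurjective _ (strictMono_ellipticJ hm) (surjective_ellipticJ hm)
  have hJ : ∀ θ, J θ = ellipticJ θ m := fun _ => rfl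
  refine ⟨J.symm, J.symm_apply_eq.2 (by rw [hJ, ellipticJ_zero]), fun y => ?_, fun y => ?_⟩
  · simpa using HasDerivAt.of_local_left_inverse J.symm.continuous.continuousAt
      (hasDerivAt_ellipticJ hm (J.symm y)) (one_div_sqrt_one_sub_mul_sin_sq_pos hm _).ne'
      (Eventually.of_forall J.apply_symm_apply)
  · rw [J.symm_apply_eq, hJ, ellipticJ_add_pi hm, ← hJ (J.symm y), J.apply_symm_apply]

theorem hasDerivAt_amplitude_deriv (hm : m < 1) {φ : ℝ → ℝ} {y : ℝ}
    (hφ : HasDerivAt φ (√(1 - m * Real.sin (φ y) ^ 2)) y) :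
    HasDerivAt (fun y => √(1 - m * Real.sin (φ y) ^ 2))
      (-(m * Real.sin (φ y) * Real.cos (φ y))) y := by
  have hpos := one_sub_mul_sin_sq_pos hm (φ y)
  have hsqrt := (Real.sqrt_pos.2 hpos).ne'
  refine ((((hφ.sin.pow 2).const_mul m).const_sub 1).sqrt hpos.ne').congr_deriv ?_
  simp only [Pi.pow_apply]
  field_simp
  ring

/-- The periodic solution is the square `sn²` of Jacobi's sine amplitude. -/
theorem exists_periodic_jacobi_sn_sq (hm : m < 1) :
    ∃ S S' : ℝ → ℝ, S 0 = 0 ∧ S' 0 = 0 ∧ (∀ y, HasDerivAt S (S' y) y) ∧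
      (∀ y, HasDerivAt S' (2 - 4 * (1 + m) * S y + 6 * m * S y ^ 2) y) ∧
      Function.Periodic S (2 * ellipticJ (Real.pi / 2) m) := by
  obtain ⟨φ, hφ0, hφ, hshift⟩ := exists_jacobi_amplitude hm
  refine ⟨fun y => Real.sin (φ y) ^ 2,
    fun y => 2 * (Real.sin (φ y) * (Real.cos (φ y) * √(1 - m * Real.sin (φ y) ^ 2))),
    by simp [hφ0], by simp [hφ0], fun y => ?_, fun y => ?_, fun y => ?_⟩
  · exact ((hφ y).sin.pow 2).congr_deriv (by push_cast; ring)
  · refine (((hφ y).sin.mul ((hφ y).cos.mul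
      (hasDerivAt_amplitude_deriv hm (hφ y)))).const_mul 2).congr_deriv ?_
    have hsq := Real.sq_sqrt (one_sub_mul_sin_sq_pos hm (φ y)).le
    simp only [Pi.mul_apply]
    linear_combination (2 * Real.cos (φ y) ^ 2 - 2 * Real.sin (φ y) ^ 2) * hsq
      + (2 - 4 * m * Real.sin (φ y) ^ 2) * Real.sin_sq_add_cos_sq (φ y)
  · simp only [hshift, Real.sin_add_pi, neg_sq]

end Elliptic

theorem metric_ode_unique {β : ℝ} {w w' W W' : ℝ → ℝ} (hw : ∀ y, HasDerivAt w (w' y) y)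
    (hw' : ∀ y, HasDerivAt w' (4 * β * w y - 12 * w y ^ 2) y) (hW : ∀ y, HasDerivAt W (W' y) y)
    (hW' : ∀ y, HasDerivAt W' (4 * β * W y - 12 * W y ^ 2) y) (h0 : w 0 = W 0)
    (h0' : w' 0 = W' 0) : w = W := by
  have hwc : Continuous w := continuous_iff_continuousAt.2 fun y => (hw y).continuousAt
  have hWc : Continuous W := continuous_iff_continuousAt.2 fun y => (hW y).continuousAt
  refine sub_eq_zero.1 (eq_zero_of_linear_second_order (g' := w' - W') (y₀ := 0)
    (c := fun y => 4 * β - 12 * (w y + W y)) (by fun_prop) (fun y => (hw y).sub (hW y))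
    (fun y => ((hw' y).sub (hW' y)).congr_deriv ?_) (sub_eq_zero.2 h0) (sub_eq_zero.2 h0'))
  simp only [Pi.sub_apply, smul_eq_mul]
  ring

section MetricOde

variable {a₁ a₂ a₃ β : ℝ}

theorem exists_periodic_metric_ode (ha₁₃ : 0 < a₁ + a₃) (ha₂₃ : 0 < a₂ + a₃)
    (hβ : β = 2 * (a₁ + a₂ - a₃)) (hrel : a₁ * a₂ = (a₁ + a₂) * a₃) :
    ∃ W W' : ℝ → ℝ, W 0 = a₁ ∧ W' 0 = 0 ∧ (∀ y, HasDerivAt W (W' y) y) ∧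
      (∀ y, HasDerivAt W' (4 * β * W y - 12 * W y ^ 2) y) ∧
      Function.Periodic W
        (2 * (ellipticJ (Real.pi / 2) ((a₁ - a₂) / (a₁ + a₃)) / √(2 * (a₁ + a₃)))) := by
  have hm : (a₁ - a₂) / (a₁ + a₃) < 1 := (div_lt_one ha₁₃).2 (by linarith)
  obtain ⟨S, S', hS0, hS0', hS, hS', hper⟩ := exists_periodic_jacobi_sn_sq hm
  set m := (a₁ - a₂) / (a₁ + a₃)
  set r := √(2 * (a₁ + a₃))
  have hr : r ≠ 0 := (Real.sqrt_pos.2 (by linarith)).ne'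
  have hr2 : r ^ 2 = 2 * (a₁ + a₃) := Real.sq_sqrt (by linarith)
  have hmul : m * (a₁ + a₃) = a₁ - a₂ := div_mul_cancel₀ _ ha₁₃.ne'
  have hscale : ∀ y, HasDerivAt (fun y => r * y) r y := fun y => by
    simpa using (hasDerivAt_id y).const_mul r
  refine ⟨fun y => a₁ - (a₁ - a₂) * S (r * y), fun y => -((a₁ - a₂) * (S' (r * y) * r)),
    by simp [hS0], by simp [hS0'], fun y => ?_, fun y => ?_, fun y => ?_⟩
  · exact (((hS (r * y)).comp y (hscale y)).const_mul _).const_sub _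
  · refine ((((hS' (r * y)).comp y (hscale y)).mul_const r).const_mul _).neg.congr_deriv ?_
    rw [hβ]
    linear_combination (-(a₁ - a₂) * (2 - 4 * (1 + m) * S (r * y) + 6 * m * S (r * y) ^ 2)) * hr2
      + (a₁ - a₂) * (8 * S (r * y) - 12 * S (r * y) ^ 2) * hmul - 4 * hrel
  · have hshift : r * (y + 2 * (ellipticJ (Real.pi / 2) m / r))
        = r * y + 2 * ellipticJ (Real.pi / 2) m := by field_simp
    simp only [hshift, hper (r * y)]

theorem periodic_of_metric_ode (ha₁₃ : 0 < a₁ + a₃) (ha₂₃ : 0 < a₂ + a₃)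
    (hβ : β = 2 * (a₁ + a₂ - a₃)) (hrel : a₁ * a₂ = (a₁ + a₂) * a₃) {w w' : ℝ → ℝ}
    (hw : ∀ y, HasDerivAt w (w' y) y) (hw' : ∀ y, HasDerivAt w' (4 * β * w y - 12 * w y ^ 2) y)
    (h0 : w 0 = a₁) (h0' : w' 0 = 0) :
    Function.Periodic w
      (2 * (ellipticJ (Real.pi / 2) ((a₁ - a₂) / (a₁ + a₃)) / √(2 * (a₁ + a₃)))) := by
  obtain ⟨W, W', hW0, hW0', hW, hW', hper⟩ := exists_periodic_metric_ode ha₁₃ ha₂₃ hβ hrel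
  rwa [metric_ode_unique hw hw' hW hW' (h0.trans hW0.symm) (h0'.trans hW0'.symm)]

end MetricOde

section Herm

variable (Z W V : Fin 3 → ℂ) (c : ℂ)

theorem herm_eq_dotProduct : herm Z W = Z ⬝ᵥ star W := rfl

theorem herm_add_left : herm (Z + W) V = herm Z V + herm W V := by
  simp [herm_eq_dotProduct, add_dotProduct]

theorem herm_add_right : herm V (Z + W) = herm V Z + herm V W := by
  simp [herm_eq_dotProduct, dotProduct_add]

theorem herm_sub_left : herm (Z - W) V = herm Z V - herm W V := by
  simp [herm_eq_dotProduct, sub_dotProduct]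

theorem herm_sub_right : herm V (Z - W) = herm V Z - herm V W := by
  simp [herm_eq_dotProduct, dotProduct_sub]

theorem herm_smul_left : herm (c • Z) W = c * herm Z W := by
  simp [herm_eq_dotProduct, smul_dotProduct]

theorem herm_smul_right : herm Z (c • W) = (starRingEnd ℂ) c * herm Z W := by
  simp [herm_eq_dotProduct, dotProduct_smul]

theorem herm_sum_left {ι : Type*} (s : Finset ι) (f : ι → Fin 3 → ℂ) :
    herm (∑ i ∈ s, f i) W = ∑ i ∈ s, herm (f i) W := by
  simp [herm_eq_dotProduct, sum_dotProduct]

theorem conj_herm : (starRingEnd ℂ) (herm Z W) = herm W Z := by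
  simp [herm, map_sum, mul_comm]

theorem herm_self : herm Z Z = ((∑ k, ‖Z k‖ ^ 2 : ℝ) : ℂ) := by
  simp [herm, Complex.mul_conj, Complex.normSq_eq_norm_sq]

variable {Z W}

theorem herm_eq_zero_comm (h : herm Z W = 0) : herm W Z = 0 := by
  rw [← conj_herm, h, map_zero]

theorem herm_mulVec {A : Matrix (Fin 3) (Fin 3) ℂ} (hA : Aᴴ * A = 1) (v w : Fin 3 → ℂ) :
    herm (A *ᵥ v) (A *ᵥ w) = herm v w := by
  rw [herm_eq_dotProduct, herm_eq_dotProduct, Matrix.star_mulVec, dotProduct_comm,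
    ← Matrix.dotProduct_mulVec, Matrix.mulVec_mulVec, hA, Matrix.one_mulVec, dotProduct_comm]

theorem norm_apply_le_one (h : herm Z Z = 1) (k : Fin 3) : ‖Z k‖ ≤ 1 := by
  have hsum : ∑ k, ‖Z k‖ ^ 2 = 1 := by exact_mod_cast (herm_self Z).symm.trans h
  rw [← sq_le_one_iff₀ (norm_nonneg _), ← hsum]
  exact Finset.single_le_sum (f := fun k => ‖Z k‖ ^ 2) (fun _ _ => by positivity)
    (Finset.mem_univ k)

theorem linearIndependent_of_herm {b : Fin 3 → Fin 3 → ℂ} {ρ : Fin 3 → ℂ}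
    (hb : ∀ i j, herm (b i) (b j) = if i = j then ρ i else 0) (hρ : ∀ i, ρ i ≠ 0) :
    LinearIndependent ℂ b := by
  refine Fintype.linearIndependent_iff.2 fun g hg i => ?_
  have h := congrArg (herm · (b i)) hg
  have hzero : herm 0 (b i) = 0 := by simp [herm]
  simpa [herm_sum_left, herm_smul_left, hb, hρ, hzero] using h

theorem sum_herm_div_smul {b : Fin 3 → Fin 3 → ℂ} {ρ : Fin 3 → ℂ}
    (hb : ∀ i j, herm (b i) (b j) = if i = j then ρ i else 0) (hρ : ∀ i, ρ i ≠ 0)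
    (V : Fin 3 → ℂ) : ∑ i, (herm V (b i) / ρ i) • b i = V := by
  let B := basisOfLinearIndependentOfCardEqFinrank (linearIndependent_of_herm hb hρ) (by simp)
  have hrepr : ∑ i, B.repr V i • b i = V := by simpa [B] using B.sum_repr V
  have hcoord : ∀ i, herm V (b i) = B.repr V i * ρ i := fun i => by
    conv_lhs => rw [← hrepr]
    simp [herm_sum_left, herm_smul_left, hb]
  simpa only [hcoord, mul_div_cancel_right₀ _ (hρ _)] using hrepr

/-- The real-bilinear form underlying `herm`, through which products `herm (A z) (B z)` are
differentiated. -/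
noncomputable def hermL : (Fin 3 → ℂ) →L[ℝ] (Fin 3 → ℂ) →L[ℝ] ℂ :=
  IsBilinearMap.toContinuousBilinearMap (f := herm)
    { add_left := fun Z W V => herm_add_left Z W V
      smul_left := fun c Z W => by
        rw [← Complex.coe_smul, herm_smul_left, Complex.real_smul]
      add_right := fun V Z W => herm_add_right Z W V
      smul_right := fun c Z W => by
        rw [← Complex.coe_smul, herm_smul_right, conj_ofReal, Complex.real_smul] }

variable {E : Type*} [NormedAddCommGroup E] [NormedSpace ℝ E] {A B : E → Fin 3 → ℂ}

theorem contDiff_herm {n : ℕ∞} (hA : ContDiff ℝ n A) (hB : ContDiff ℝ n B) :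
    ContDiff ℝ n fun z => herm (A z) (B z) :=
  hermL.isBoundedBilinearMap.contDiff.comp (hA.prodMk hB)

theorem differentiable_herm (hA : Differentiable ℝ A) (hB : Differentiable ℝ B) :
    Differentiable ℝ fun z => herm (A z) (B z) := fun z =>
  (hermL.hasFDerivAt_of_bilinear (hA z).hasFDerivAt (hB z).hasFDerivAt).differentiableAt

theorem fderiv_herm {z : E} (hA : DifferentiableAt ℝ A z) (hB : DifferentiableAt ℝ B z) (v : E) :
    fderiv ℝ (fun z => herm (A z) (B z)) z v =
      herm (fderiv ℝ A z v) (B z) + herm (A z) (fderiv ℝ B z v) :=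
  (congrArg (· v) (hermL.fderiv_of_bilinear hA hB)).trans (add_comm _ _)

end Herm

section Wirtinger

variable {E : Type*} [NormedAddCommGroup E] [NormedSpace ℂ E] {F : ℂ → E}

/-- The Wirtinger derivative `∂/∂z` of a map into a complex normed space; on maps into `ℂ³` it is
`dz`. -/
noncomputable def wz (F : ℂ → E) (z : ℂ) : E :=
  (1 / 2 : ℂ) • (fderiv ℝ F z 1 - I • fderiv ℝ F z I)

/-- The Wirtinger derivative `∂/∂z̄` of a map into a complex normed space; on maps into `ℂ³` it is
`dzbar`. -/
noncomputable def wzbar (F : ℂ → E) (z : ℂ) : E :=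
  (1 / 2 : ℂ) • (fderiv ℝ F z 1 + I • fderiv ℝ F z I)

theorem fderiv_one_eq (F : ℂ → E) (z : ℂ) : fderiv ℝ F z 1 = wz F z + wzbar F z := by
  unfold wz wzbar; module

theorem fderiv_I_eq (F : ℂ → E) (z : ℂ) : fderiv ℝ F z I = I • (wz F z - wzbar F z) := by
  have hI : I • (wz F z - wzbar F z) = (-(I * I)) • fderiv ℝ F z I := by
    unfold wz wzbar; module
  rw [hI, I_mul_I, neg_neg, one_smul]

theorem fderiv_apply_eq (F : ℂ → E) (z v : ℂ) :
    fderiv ℝ F z v = v • wz F z + (starRingEnd ℂ) v • wzbar F z := by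
  have hv : fderiv ℝ F z v = v.re • fderiv ℝ F z 1 + v.im • fderiv ℝ F z I := by
    rw [← map_smul, ← map_smul, ← map_add, real_smul, real_smul, mul_one, re_add_im]
  rw [hv, fderiv_one_eq, fderiv_I_eq, ← Complex.coe_smul, ← Complex.coe_smul]
  conv_rhs => rw [← re_add_im v]
  simp only [map_add, map_mul, conj_ofReal, conj_I]
  module

theorem contDiff_fderiv_apply {E : Type*} [NormedAddCommGroup E] [NormedSpace ℝ E] {F : ℂ → E}
    (hF : ContDiff ℝ ∞ F) (v : ℂ) : ContDiff ℝ ∞ fun z => fderiv ℝ F z v :=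
  (hF.fderiv_right (m := ∞) (by simp)).clm_apply contDiff_const

theorem contDiff_wz (hF : ContDiff ℝ ∞ F) : ContDiff ℝ ∞ (wz F) :=
  ((contDiff_fderiv_apply hF 1).sub ((contDiff_fderiv_apply hF I).const_smul I)).const_smul _

theorem contDiff_wzbar (hF : ContDiff ℝ ∞ F) : ContDiff ℝ ∞ (wzbar F) :=
  ((contDiff_fderiv_apply hF 1).add ((contDiff_fderiv_apply hF I).const_smul I)).const_smul _

theorem fderiv_fderiv_comm (hF : ContDiff ℝ ∞ F) (v w z : ℂ) :
    fderiv ℝ (fun z => fderiv ℝ F z v) z w = fderiv ℝ (fun z => fderiv ℝ F z w) z v := by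
  have hF' : DifferentiableAt ℝ (fderiv ℝ F) z :=
    (hF.fderiv_right (m := ∞) (by simp)).differentiable (by simp) z
  have hsymm : IsSymmSndFDerivAt ℝ F z :=
    hF.contDiffAt.isSymmSndFDerivAt (by
      rw [minSmoothness_of_isRCLikeNormedField]
      exact WithTop.coe_le_coe.2 (le_top : (2 : ℕ∞) ≤ ⊤))
  simpa [fderiv_clm_apply hF' (differentiableAt_const _)] using hsymm w v

theorem wz_wzbar_eq_wzbar_wz (hF : ContDiff ℝ ∞ F) (z : ℂ) : wz (wzbar F) z = wzbar (wz F) z := by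
  have hdiff : ∀ v, HasFDerivAt (fun z => fderiv ℝ F z v)
      (fderiv ℝ (fun z => fderiv ℝ F z v) z) z := fun v =>
    ((contDiff_fderiv_apply hF v).differentiable (by simp) z).hasFDerivAt
  have hwz : fderiv ℝ (wz F) z = _ :=
    (((hdiff 1).sub ((hdiff I).const_smul I)).const_smul (1 / 2 : ℂ)).fderiv
  have hwzbar : fderiv ℝ (wzbar F) z = _ :=
    (((hdiff 1).add ((hdiff I).const_smul I)).const_smul (1 / 2 : ℂ)).fderiv
  rw [wz, wzbar, hwz, hwzbar]
  simp only [_root_.smul_apply, _root_.sub_apply, _root_.add_apply, fderiv_fderiv_comm hF I 1]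
  module

theorem fderiv_fderiv_one_add_fderiv_fderiv_I (hF : ContDiff ℝ ∞ F) (z : ℂ) :
    fderiv ℝ (fun z => fderiv ℝ F z 1) z 1 + fderiv ℝ (fun z => fderiv ℝ F z I) z I =
      (4 : ℂ) • wzbar (wz F) z := by
  have hwz := (contDiff_wz hF).differentiable (by simp) z
  have hwzbar := (contDiff_wzbar hF).differentiable (by simp) z
  have hI : fderiv ℝ (fun z => I • (wz F z - wzbar F z)) z = _ :=
    ((hwz.hasFDerivAt.sub hwzbar.hasFDerivAt).const_smul I).fderiv
  rw [funext (fderiv_I_eq F), hI, funext (fderiv_one_eq F), fderiv_fun_add hwz hwzbar]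
  simp only [_root_.add_apply, _root_.smul_apply, _root_.sub_apply, fderiv_one_eq, fderiv_I_eq,
    ← smul_sub, smul_smul, I_mul_I, wz_wzbar_eq_wzbar_wz hF]
  module

theorem fderiv_fderiv_one (hF : ContDiff ℝ ∞ F) (z : ℂ) :
    fderiv ℝ (fun z => fderiv ℝ F z 1) z 1 =
      wz (wz F) z + (2 : ℂ) • wzbar (wz F) z + wzbar (wzbar F) z := by
  rw [funext (fderiv_one_eq F), fderiv_fun_add ((contDiff_wz hF).differentiable (by simp) z)
    ((contDiff_wzbar hF).differentiable (by simp) z)]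
  simp only [_root_.add_apply, fderiv_one_eq, wz_wzbar_eq_wzbar_wz hF]
  module

theorem wz_herm {A B : ℂ → Fin 3 → ℂ} {z : ℂ} (hA : DifferentiableAt ℝ A z)
    (hB : DifferentiableAt ℝ B z) :
    wz (fun z => herm (A z) (B z)) z = herm (wz A z) (B z) + herm (A z) (wzbar B z) := by
  simp only [wz, wzbar, fderiv_herm hA hB, herm_smul_left, herm_smul_right, herm_sub_left,
    herm_add_right, smul_eq_mul, map_div₀, map_one, map_ofNat, conj_I]
  ring

theorem wzbar_herm {A B : ℂ → Fin 3 → ℂ} {z : ℂ} (hA : DifferentiableAt ℝ A z)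
    (hB : DifferentiableAt ℝ B z) :
    wzbar (fun z => herm (A z) (B z)) z = herm (wzbar A z) (B z) + herm (A z) (wz B z) := by
  simp only [wz, wzbar, fderiv_herm hA hB, herm_smul_left, herm_smul_right, herm_sub_right,
    herm_add_left, smul_eq_mul, map_div₀, map_one, map_ofNat, conj_I]
  ring

theorem wz_smul {a : ℂ → ℂ} {z : ℂ} (ha : DifferentiableAt ℝ a z) (hF : DifferentiableAt ℝ F z) :
    wz (fun z => a z • F z) z = wz a z • F z + a z • wz F z := by
  simp only [wz, fderiv_fun_smul ha hF, _root_.add_apply, _root_.smul_apply,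
    ContinuousLinearMap.smulRight_apply]
  module

@[simp] theorem wz_const (c : E) (z : ℂ) : wz (fun _ => c) z = 0 := by simp [wz]

@[simp] theorem wzbar_const (c : E) (z : ℂ) : wzbar (fun _ => c) z = 0 := by simp [wzbar]

theorem wz_neg (F : ℂ → E) (z : ℂ) : wz (fun z => -F z) z = -wz F z := by
  simp only [wz, fderiv_fun_neg, _root_.neg_apply]
  module

section LinearMap

variable {E' : Type*} [NormedAddCommGroup E'] [NormedSpace ℂ E'] (L : E →L[ℂ] E') {z : ℂ}

theorem fderiv_clm_comp (hF : DifferentiableAt ℝ F z) (v : ℂ) :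
    fderiv ℝ (fun z => L (F z)) z v = L (fderiv ℝ F z v) :=
  congrArg (· v) ((L.restrictScalars ℝ).hasFDerivAt.comp z hF.hasFDerivAt).fderiv

theorem wz_clm_comp (hF : DifferentiableAt ℝ F z) : wz (fun z => L (F z)) z = L (wz F z) := by
  simp only [wz, fderiv_clm_comp L hF, map_smul, map_sub]

theorem wzbar_clm_comp (hF : DifferentiableAt ℝ F z) :
    wzbar (fun z => L (F z)) z = L (wzbar F z) := by
  simp only [wzbar, fderiv_clm_comp L hF, map_smul, map_add]

end LinearMap

theorem wz_comp_add_left (c z : ℂ) : wz (fun z => F (c + z)) z = wz F (c + z) := by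
  simp only [wz, fderiv_comp_add_left]

theorem wzbar_comp_add_left (c z : ℂ) : wzbar (fun z => F (c + z)) z = wzbar F (c + z) := by
  simp only [wzbar, fderiv_comp_add_left]

theorem wz_of_fderiv_one_eq_zero {z : ℂ} (h : fderiv ℝ F z 1 = 0) :
    wz F z = (-(I / 2)) • fderiv ℝ F z I := by
  rw [wz, h]; module

theorem wzbar_of_fderiv_one_eq_zero {z : ℂ} (h : fderiv ℝ F z 1 = 0) :
    wzbar F z = (I / 2) • fderiv ℝ F z I := by
  rw [wzbar, h]; module

theorem fderiv_ofReal_comp {e : ℂ → ℝ} (he : Differentiable ℝ e) (z v : ℂ) :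
    fderiv ℝ (fun z => (e z : ℂ)) z v = (fderiv ℝ e z v : ℝ) :=
  congrArg (· v) (Complex.ofRealCLM.hasFDerivAt.comp z (he z).hasFDerivAt).fderiv

theorem conj_wz_ofReal {e : ℂ → ℝ} (he : Differentiable ℝ e) (z : ℂ) :
    (starRingEnd ℂ) (wz (fun z => (e z : ℂ)) z) = wzbar (fun z => (e z : ℂ)) z := by
  simp [wz, wzbar, fderiv_ofReal_comp he, map_ofNat (starRingEnd ℂ) 2]

end Wirtinger

section Lines

variable {E : Type*} [NormedAddCommGroup E] [NormedSpace ℝ E] {G : ℂ → E}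

theorem hasDerivAt_line (hG : Differentiable ℝ G) (z v : ℂ) (t : ℝ) :
    HasDerivAt (fun s : ℝ => G (s * v + z)) (fderiv ℝ G (t * v + z) v) t := by
  have hline : HasDerivAt (fun s : ℝ => (s : ℂ) * v + z) v t := by
    simpa using ((Complex.ofRealCLM.hasDerivAt (x := t)).mul_const v).add_const z
  exact (hG _).hasFDerivAt.comp_hasDerivAt t hline

theorem hasDerivAt_imag (hG : Differentiable ℝ G) (y : ℝ) :
    HasDerivAt (fun s : ℝ => G (s * I)) (fderiv ℝ G (y * I) I) y := by
  simpa using hasDerivAt_line hG 0 I y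

theorem fderiv_one_eq_zero (hG : Differentiable ℝ G) (h : ∀ (t : ℝ) z, G (t + z) = G z) (z : ℂ) :
    fderiv ℝ G z 1 = 0 := by
  have hder := hasDerivAt_line hG z 1 0
  simp only [mul_one, h, ofReal_zero, zero_add] at hder
  exact hder.unique (hasDerivAt_const _ _)

end Lines

section MinimalLift

/-- `F : ℂ → S⁵` is a horizontal lift of a conformal minimal Lagrangian immersion with metric
`2 e dz dz̄` and Hopf differential `Ψ dz³`. The metric is carried by `e = e^u` instead of `u`,
because every structure equation is polynomial in `e` and its derivatives. -/
structure IsMinimalLift (F : ℂ → Fin 3 → ℂ) (e : ℂ → ℝ) (Ψ : ℂ → ℂ) : Prop where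
  smooth : ContDiff ℝ ∞ F
  norm_one : ∀ z, herm (F z) (F z) = 1
  horizontal : ∀ z, herm (wz F z) (F z) = 0
  horizontal' : ∀ z, herm (wzbar F z) (F z) = 0
  pos : ∀ z, 0 < e z
  metric : ∀ z, herm (wz F z) (wz F z) = e z
  metric' : ∀ z, herm (wzbar F z) (wzbar F z) = e z
  conformal : ∀ z, herm (wz F z) (wzbar F z) = 0
  minimal : ∀ z, ∃ c : ℂ, wzbar (wz F) z = c • F z
  hopf : ∀ z, Ψ z = herm (wz (wz F) z) (wzbar F z)

/-- The moving frame `(F_z, F_z̄, F)` of a map into `ℂ³`, left unnormalized so that no square root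
of the metric enters. -/
noncomputable def frame (F : ℂ → Fin 3 → ℂ) (z : ℂ) : Fin 3 → Fin 3 → ℂ :=
  ![wz F z, wzbar F z, F z]

namespace IsMinimalLift

variable {F : ℂ → Fin 3 → ℂ} {e : ℂ → ℝ} {Ψ : ℂ → ℂ}

theorem differentiable (h : IsMinimalLift F e Ψ) : Differentiable ℝ F :=
  h.smooth.differentiable (by simp)

theorem differentiable_wz (h : IsMinimalLift F e Ψ) : Differentiable ℝ (wz F) :=
  (contDiff_wz h.smooth).differentiable (by simp)

theorem differentiable_wzbar (h : IsMinimalLift F e Ψ) : Differentiable ℝ (wzbar F) :=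
  (contDiff_wzbar h.smooth).differentiable (by simp)

theorem differentiable_wz_wz (h : IsMinimalLift F e Ψ) : Differentiable ℝ (wz (wz F)) :=
  (contDiff_wz (contDiff_wz h.smooth)).differentiable (by simp)

theorem metric_ne_zero (h : IsMinimalLift F e Ψ) (z : ℂ) : (e z : ℂ) ≠ 0 :=
  ofReal_ne_zero.2 (h.pos z).ne'

theorem contDiff_metric (h : IsMinimalLift F e Ψ) : ContDiff ℝ ∞ e := by
  have he : e = fun z => (herm (wz F z) (wz F z)).re := funext fun z => by
    rw [h.metric, ofReal_re]
  rw [he]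
  exact reCLM.contDiff.comp (contDiff_herm (contDiff_wz h.smooth) (contDiff_wz h.smooth))

theorem differentiable_metric (h : IsMinimalLift F e Ψ) : Differentiable ℝ e :=
  h.contDiff_metric.differentiable (by simp)

theorem differentiable_ofReal_metric (h : IsMinimalLift F e Ψ) :
    Differentiable ℝ fun z => (e z : ℂ) :=
  (Complex.ofRealCLM.contDiff.comp h.contDiff_metric).differentiable (by simp)

theorem herm_frame (h : IsMinimalLift F e Ψ) (z : ℂ) (i j : Fin 3) :
    herm (frame F z i) (frame F z j) = if i = j then ![(e z : ℂ), e z, 1] i else 0 := by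
  fin_cases i <;> fin_cases j <;>
    simp [frame, h.norm_one, h.metric, h.metric', h.horizontal, h.horizontal', h.conformal,
      herm_eq_zero_comm (h.horizontal z), herm_eq_zero_comm (h.horizontal' z),
      herm_eq_zero_comm (h.conformal z)]

theorem herm_frame_ne_zero (h : IsMinimalLift F e Ψ) (z : ℂ) (i : Fin 3) :
    ![(e z : ℂ), e z, 1] i ≠ 0 := by
  fin_cases i <;> simp [(h.pos z).ne']

theorem frame_expansion (h : IsMinimalLift F e Ψ) (z : ℂ) (V : Fin 3 → ℂ) :
    V = (herm V (wz F z) / e z) • wz F z + (herm V (wzbar F z) / e z) • wzbar F z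
      + herm V (F z) • F z := by
  simpa [Fin.sum_univ_three, frame] using
    (sum_herm_div_smul (h.herm_frame z) (h.herm_frame_ne_zero z) V).symm

theorem wzbar_wz (h : IsMinimalLift F e Ψ) (z : ℂ) : wzbar (wz F) z = -(e z : ℂ) • F z := by
  obtain ⟨c, hc⟩ := h.minimal z
  have hder := wzbar_herm (h.differentiable_wz z) (h.differentiable z)
  rw [funext h.horizontal, wzbar_const, hc, herm_smul_left, h.norm_one, h.metric] at hder
  rw [hc]
  congr 1
  linear_combination -hder

theorem wz_wzbar (h : IsMinimalLift F e Ψ) (z : ℂ) : wz (wzbar F) z = -(e z : ℂ) • F z := by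
  rw [wz_wzbar_eq_wzbar_wz h.smooth, h.wzbar_wz]

theorem herm_wz_wz_wz (h : IsMinimalLift F e Ψ) (z : ℂ) :
    herm (wz (wz F) z) (wz F z) = wz (fun z => (e z : ℂ)) z := by
  rw [← funext h.metric, wz_herm (h.differentiable_wz z) (h.differentiable_wz z), h.wzbar_wz,
    herm_smul_right, h.horizontal, mul_zero, add_zero]

theorem herm_wz_wz_self (h : IsMinimalLift F e Ψ) (z : ℂ) : herm (wz (wz F) z) (F z) = 0 := by
  have hder := wz_herm (h.differentiable_wz z) (h.differentiable z)
  rw [funext h.horizontal, wz_const, h.conformal, add_zero] at hder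
  exact hder.symm

theorem herm_wzbar_wzbar_wzbar (h : IsMinimalLift F e Ψ) (z : ℂ) :
    herm (wzbar (wzbar F) z) (wzbar F z) = wzbar (fun z => (e z : ℂ)) z := by
  rw [← funext h.metric', wzbar_herm (h.differentiable_wzbar z) (h.differentiable_wzbar z),
    h.wz_wzbar, herm_smul_right, h.horizontal', mul_zero, add_zero]

theorem herm_wzbar_wzbar_self (h : IsMinimalLift F e Ψ) (z : ℂ) :
    herm (wzbar (wzbar F) z) (F z) = 0 := by
  have hder := wzbar_herm (h.differentiable_wzbar z) (h.differentiable z)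
  rw [funext h.horizontal', wzbar_const, herm_eq_zero_comm (h.conformal z), add_zero] at hder
  exact hder.symm

theorem herm_wzbar_wzbar_wz (h : IsMinimalLift F e Ψ) (z : ℂ) :
    herm (wzbar (wzbar F) z) (wz F z) = -(starRingEnd ℂ) (Ψ z) := by
  have hder := wzbar_herm (h.differentiable_wzbar z) (h.differentiable_wz z)
  rw [funext fun z => herm_eq_zero_comm (h.conformal z), wzbar_const] at hder
  rw [h.hopf, conj_herm]
  linear_combination -hder

theorem wz_wz (h : IsMinimalLift F e Ψ) (z : ℂ) :
    wz (wz F) z = (wz (fun z => (e z : ℂ)) z / e z) • wz F z + (Ψ z / e z) • wzbar F z := by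
  conv_lhs => rw [h.frame_expansion z (wz (wz F) z)]
  rw [h.herm_wz_wz_wz, h.herm_wz_wz_self, ← h.hopf, zero_smul, add_zero]

theorem wzbar_wzbar (h : IsMinimalLift F e Ψ) (z : ℂ) :
    wzbar (wzbar F) z = (-(starRingEnd ℂ) (Ψ z) / e z) • wz F z
      + (wzbar (fun z => (e z : ℂ)) z / e z) • wzbar F z := by
  conv_lhs => rw [h.frame_expansion z (wzbar (wzbar F) z)]
  rw [h.herm_wzbar_wzbar_wzbar, h.herm_wzbar_wzbar_self, h.herm_wzbar_wzbar_wz, zero_smul,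
    add_zero]

theorem wzbar_wz_wz (h : IsMinimalLift F e Ψ) (z : ℂ) :
    wzbar (wz (wz F)) z = -(wz (fun z => (e z : ℂ)) z) • F z - (e z : ℂ) • wz F z := by
  rw [← wz_wzbar_eq_wzbar_wz (contDiff_wz h.smooth), funext h.wzbar_wz,
    wz_smul (a := fun z => -(e z : ℂ)) (h.differentiable_ofReal_metric.neg z) (h.differentiable z),
    wz_neg fun z => (e z : ℂ)]
  module

theorem wzbar_hopf (h : IsMinimalLift F e Ψ) (z : ℂ) : wzbar Ψ z = 0 := by
  rw [funext h.hopf, wzbar_herm (h.differentiable_wz_wz z) (h.differentiable_wzbar z),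
    h.wz_wzbar, h.wzbar_wz_wz, herm_smul_right, h.herm_wz_wz_self, herm_sub_left, herm_smul_left,
    herm_smul_left, h.conformal, herm_eq_zero_comm (h.horizontal' z)]
  simp

theorem contDiff_hopf (h : IsMinimalLift F e Ψ) : ContDiff ℝ ∞ Ψ := by
  rw [funext h.hopf]
  exact contDiff_herm (contDiff_wz (contDiff_wz h.smooth)) (contDiff_wzbar h.smooth)

theorem herm_wz_wz_wz_wz (h : IsMinimalLift F e Ψ) (z : ℂ) :
    herm (wz (wz F) z) (wz (wz F) z) = wz (fun z => (e z : ℂ)) z / e z *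
      wzbar (fun z => (e z : ℂ)) z + Ψ z / e z * (starRingEnd ℂ) (Ψ z) := by
  conv_lhs => enter [1]; rw [h.wz_wz]
  rw [herm_add_left, herm_smul_left, herm_smul_left, ← conj_herm (wz (wz F) z) (wz F z),
    h.herm_wz_wz_wz, ← conj_herm (wz (wz F) z) (wzbar F z), ← h.hopf,
    conj_wz_ofReal h.differentiable_metric]

/-- The Gauss equation, obtained by differentiating `F_zz · conj F_z = e_z` by `z̄`. -/
theorem gauss (h : IsMinimalLift F e Ψ) (z : ℂ) :
    e z * wzbar (wz fun z => (e z : ℂ)) z = -(e z : ℂ) ^ 3 +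
      wz (fun z => (e z : ℂ)) z * wzbar (fun z => (e z : ℂ)) z
        + Ψ z * (starRingEnd ℂ) (Ψ z) := by
  have he := h.metric_ne_zero z
  rw [← funext h.herm_wz_wz_wz, wzbar_herm (h.differentiable_wz_wz z) (h.differentiable_wz z),
    h.wzbar_wz_wz, herm_sub_left, herm_smul_left, herm_smul_left, h.metric,
    herm_eq_zero_comm (h.horizontal z), h.herm_wz_wz_wz_wz, funext h.herm_wz_wz_wz]
  field_simp
  ring

theorem herm_fderiv (h : IsMinimalLift F e Ψ) (z v : ℂ) : herm (fderiv ℝ F z v) (F z) = 0 := by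
  rw [fderiv_apply_eq, herm_add_left, herm_smul_left, herm_smul_left, h.horizontal,
    h.horizontal', mul_zero, mul_zero, add_zero]

end IsMinimalLift

end MinimalLift

section HorizontalLift

variable {F H : ℂ → Fin 3 → ℂ} {e : ℂ → ℝ} {Ψ : ℂ → ℂ} {f : ℂ → CP2}

theorem eq_herm_smul_of_eq_smul {Z W : Fin 3 → ℂ} (hZ : herm Z Z = 1) (h : ∃ c : ℂ, W = c • Z) :
    W = herm W Z • Z := by
  obtain ⟨c, rfl⟩ := h
  rw [herm_smul_left, hZ, mul_one]

theorem conj_herm_mul_herm_eq_one {Z W : Fin 3 → ℂ} (hZ : herm Z Z = 1) (hW : herm W W = 1)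
    (h : ∃ c : ℂ, W = c • Z) : (starRingEnd ℂ) (herm W Z) * herm W Z = 1 := by
  obtain ⟨c, rfl⟩ := h
  simpa [herm_smul_left, herm_smul_right, hZ] using hW

theorem horizontal_lift_unique (hF : Differentiable ℝ F) (hH : Differentiable ℝ H)
    (hF1 : ∀ z, herm (F z) (F z) = 1) (hH1 : ∀ z, herm (H z) (H z) = 1)
    (hF' : ∀ z v, herm (fderiv ℝ F z v) (F z) = 0) (hH' : ∀ z v, herm (fderiv ℝ H z v) (H z) = 0)
    (hc : ∀ z, ∃ c : ℂ, H z = c • F z) :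
    ∃ c : ℂ, (starRingEnd ℂ) c * c = 1 ∧ ∀ z, H z = c • F z := by
  have hHF : ∀ z, H z = herm (H z) (F z) • F z := fun z => eq_herm_smul_of_eq_smul (hF1 z) (hc z)
  have hunit : ∀ z, (starRingEnd ℂ) (herm (H z) (F z)) * herm (H z) (F z) = 1 := fun z =>
    conj_herm_mul_herm_eq_one (hF1 z) (hH1 z) (hc z)
  have hFH : ∀ z, F z = herm (F z) (H z) • H z := fun z => by
    conv_rhs => rw [hHF z, ← conj_herm, herm_smul_left, hF1, mul_one, smul_smul, hunit]
    rw [one_smul]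
  have hconst := is_const_of_fderiv_eq_zero (differentiable_herm hH hF) fun z => by
    ext1 v
    have hHF' : herm (fderiv ℝ H z v) (F z) = 0 := by
      rw [hFH z, herm_smul_right, hH', mul_zero]
    have hFH' : herm (H z) (fderiv ℝ F z v) = 0 := by
      rw [hHF z, herm_smul_left, herm_eq_zero_comm (hF' z v), mul_zero]
    rw [fderiv_herm (hH z) (hF z), hHF', hFH', add_zero, _root_.zero_apply]
  exact ⟨herm (H 0) (F 0), hunit 0, fun z => by rw [hconst 0 z]; exact hHF z⟩

/-- `F` represents `f : ℂ → ℂP²` in homogeneous coordinates. -/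
def IsLift (F : ℂ → Fin 3 → ℂ) (f : ℂ → CP2) : Prop :=
  ∀ z, ∃ h : F z ≠ 0, f z = Projectivization.mk ℂ (F z) h

theorem IsLift.apply_eq_iff {G : ℂ → Fin 3 → ℂ} {g : ℂ → CP2} (hF : IsLift F f) (hG : IsLift G g)
    (z z' : ℂ) : f z = g z' ↔ ∃ c : ℂ, F z = c • G z' := by
  obtain ⟨hz, hfz⟩ := hF z
  obtain ⟨hz', hgz'⟩ := hG z'
  rw [hfz, hgz', Projectivization.mk_eq_mk_iff']
  simp only [eq_comm]

theorem IsLift.su3Act (hl : IsLift F f) (A : Matrix.specialUnitaryGroup (Fin 3) ℂ) :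
    IsLift (fun z => (A : Matrix (Fin 3) (Fin 3) ℂ) *ᵥ F z) fun z => su3Act A (f z) := fun z => by
  obtain ⟨hz, hfz⟩ := hl z
  exact ⟨fun h => hz (toLin'_injective A (by simpa using h)), congrArg (MinLag.su3Act A) hfz⟩

/-- A minimal lift on whose image every real translation acts by a unitary map of `ℂ³`. Lifting
`SU(3)`-equivariance of `f` gives the unitary maps only up to a unit scalar, so they are not
required to form a one-parameter group. -/
structure IsEquivariantLift (F : ℂ → Fin 3 → ℂ) (e : ℂ → ℝ) (Ψ : ℂ → ℂ) : Prop
    extends IsMinimalLift F e Ψ where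
  translator : ∀ t : ℝ, ∃ S : (Fin 3 → ℂ) →L[ℂ] (Fin 3 → ℂ),
    (∀ V W, herm (S V) (S W) = herm V W) ∧ ∀ z, F (t + z) = S (F z)

theorem IsMinimalLift.isEquivariantLift (h : IsMinimalLift F e Ψ) (hl : IsLift F f)
    (hequiv : IsTranslationallyEquivariant f) : IsEquivariantLift F e Ψ := by
  refine ⟨h, fun t => ?_⟩
  obtain ⟨R, -, hR⟩ := hequiv
  set A := R (Multiplicative.ofAdd t)
  let L := (Matrix.toLin' (A : Matrix (Fin 3) (Fin 3) ℂ)).toContinuousLinearMap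
  have hL : ∀ V W, herm (L V) (L W) = herm V W :=
    herm_mulVec ((Matrix.mem_unitaryGroup_iff').1 (Matrix.mem_specialUnitaryGroup_iff.1 A.2).1)
  obtain ⟨c, hc, hcF⟩ := horizontal_lift_unique (F := fun z => L (F z)) (H := fun z => F (t + z))
    ((L.restrictScalars ℝ).differentiable.comp h.differentiable)
    (h.differentiable.comp ((differentiable_const _).add differentiable_id))
    (fun z => by rw [hL, h.norm_one]) (fun z => h.norm_one _)
    (fun z v => by rw [fderiv_clm_comp L (h.differentiable z), hL, h.herm_fderiv])
    (fun z v => by rw [fderiv_comp_add_left, h.herm_fderiv])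
    (fun z => (hl.apply_eq_iff (hl.su3Act A) _ _).1 (hR t z))
  refine ⟨c • L, fun V W => ?_, hcF⟩
  simp only [_root_.smul_apply, herm_smul_left, herm_smul_right, hL]
  rw [← mul_assoc, hc, one_mul]

theorem exists_equivariantLift {u : ℂ → ℝ} (hf : IsMinimalLagrangian f u Ψ)
    (hequiv : IsTranslationallyEquivariant f) :
    ∃ F, IsEquivariantLift F (fun z => Real.exp (u z)) Ψ ∧ IsLift F f := by
  obtain ⟨F, hF, hm, hm', hc, hmin, hΨ⟩ := hf
  have h : IsMinimalLift F (fun z => Real.exp (u z)) Ψ :=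
    ⟨hF.smooth, hF.norm_one, hF.horizontal, hF.horizontal', fun z => Real.exp_pos _, hm, hm', hc,
      hmin, hΨ⟩
  exact ⟨F, h.isEquivariantLift hF.lifts hequiv, hF.lifts⟩

end HorizontalLift

section EquivariantLift

variable {F : ℂ → Fin 3 → ℂ} {e : ℂ → ℝ} {Ψ : ℂ → ℂ}

theorem wz_translate {S : (Fin 3 → ℂ) →L[ℂ] (Fin 3 → ℂ)} {t : ℂ} (hF : Differentiable ℝ F)
    (hS : ∀ z, F (t + z) = S (F z)) (z : ℂ) : wz F (t + z) = S (wz F z) := by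
  rw [← wz_comp_add_left, funext hS, wz_clm_comp S (hF z)]

theorem wzbar_translate {S : (Fin 3 → ℂ) →L[ℂ] (Fin 3 → ℂ)} {t : ℂ} (hF : Differentiable ℝ F)
    (hS : ∀ z, F (t + z) = S (F z)) (z : ℂ) : wzbar F (t + z) = S (wzbar F z) := by
  rw [← wzbar_comp_add_left, funext hS, wzbar_clm_comp S (hF z)]

namespace IsEquivariantLift

theorem metric_translate (h : IsEquivariantLift F e Ψ) (t : ℝ) (z : ℂ) : e (t + z) = e z := by
  obtain ⟨S, hherm, hS⟩ := h.translator t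
  have hmetric := h.metric (t + z)
  rw [wz_translate h.differentiable hS, hherm, h.metric] at hmetric
  exact_mod_cast hmetric.symm

theorem hopf_translate (h : IsEquivariantLift F e Ψ) (t : ℝ) (z : ℂ) : Ψ (t + z) = Ψ z := by
  obtain ⟨S, hherm, hS⟩ := h.translator t
  rw [h.hopf, h.hopf, wz_translate h.differentiable_wz (wz_translate h.differentiable hS),
    wzbar_translate h.differentiable hS, hherm]

theorem hopf_const (h : IsEquivariantLift F e Ψ) (z : ℂ) : Ψ z = Ψ 0 := by
  have hΨ : Differentiable ℝ Ψ := h.contDiff_hopf.differentiable (by simp)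
  refine is_const_of_fderiv_eq_zero hΨ (fun z => ?_) z 0
  have hwz : wz Ψ z = 0 := by
    have hx := fderiv_one_eq_zero hΨ h.hopf_translate z
    rwa [fderiv_one_eq, h.wzbar_hopf, add_zero] at hx
  ext1 v
  rw [fderiv_apply_eq, hwz, h.wzbar_hopf, smul_zero, smul_zero, add_zero, _root_.zero_apply]

theorem fderiv_ofReal_metric_one (h : IsEquivariantLift F e Ψ) (z : ℂ) :
    fderiv ℝ (fun z => (e z : ℂ)) z 1 = 0 :=
  fderiv_one_eq_zero h.differentiable_ofReal_metric
    (fun t z => congrArg _ (h.metric_translate t z)) z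

theorem wz_metric (h : IsEquivariantLift F e Ψ) (z : ℂ) :
    wz (fun z => (e z : ℂ)) z = -(I / 2) * (fderiv ℝ e z I : ℝ) := by
  rw [wz_of_fderiv_one_eq_zero (h.fderiv_ofReal_metric_one z),
    fderiv_ofReal_comp h.differentiable_metric, smul_eq_mul]

theorem wzbar_metric (h : IsEquivariantLift F e Ψ) (z : ℂ) :
    wzbar (fun z => (e z : ℂ)) z = I / 2 * (fderiv ℝ e z I : ℝ) := by
  rw [wzbar_of_fderiv_one_eq_zero (h.fderiv_ofReal_metric_one z),
    fderiv_ofReal_comp h.differentiable_metric, smul_eq_mul]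

theorem wzbar_wz_metric (h : IsEquivariantLift F e Ψ) (z : ℂ) :
    4 * wzbar (wz fun z => (e z : ℂ)) z = (fderiv ℝ (fun z => fderiv ℝ e z I) z I : ℝ) := by
  have he := h.contDiff_metric
  rw [← smul_eq_mul, ← fderiv_fderiv_one_add_fderiv_fderiv_I (F := fun z => (e z : ℂ))
      (Complex.ofRealCLM.contDiff.comp he),
    funext h.fderiv_ofReal_metric_one,
    funext fun z => fderiv_ofReal_comp h.differentiable_metric z I,
    fderiv_ofReal_comp ((contDiff_fderiv_apply he I).differentiable (by simp))]
  simp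

theorem gauss_translate (h : IsEquivariantLift F e Ψ) (z : ℂ) :
    e z * fderiv ℝ (fun z => fderiv ℝ e z I) z I
      = (fderiv ℝ e z I) ^ 2 - 4 * e z ^ 3 + 4 * ‖Ψ z‖ ^ 2 := by
  have hgauss := h.gauss z
  rw [h.wz_metric, h.wzbar_metric, Complex.mul_conj'] at hgauss
  apply ofReal_injective
  push_cast
  rw [← h.wzbar_wz_metric]
  linear_combination 4 * hgauss - ((fderiv ℝ e z I : ℝ) : ℂ) ^ 2 * I_sq

end IsEquivariantLift

theorem metric_first_integral {w w' w'' : ℝ → ℝ} {q β : ℝ} (hpos : ∀ y, 0 < w y)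
    (hw : ∀ y, HasDerivAt w (w' y) y) (hw' : ∀ y, HasDerivAt w' (w'' y) y)
    (hode : ∀ y, w y * w'' y = w' y ^ 2 - 4 * w y ^ 3 + 4 * q)
    (h0 : w' 0 ^ 2 = 4 * β * w 0 ^ 2 - 8 * w 0 ^ 3 - 4 * q) (y : ℝ) :
    w' y ^ 2 = 4 * β * w y ^ 2 - 8 * w y ^ 3 - 4 * q := by
  have hne : ∀ y, w y ≠ 0 := fun y => (hpos y).ne'
  have hder : ∀ y, HasDerivAt (fun y => (w' y ^ 2 + 8 * w y ^ 3 + 4 * q) / w y ^ 2) 0 y := by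
    intro y
    refine (((((hw' y).fun_pow 2).fun_add (((hw y).fun_pow 3).const_mul 8)).add_const
      (4 * q)).fun_div ((hw y).fun_pow 2) (pow_ne_zero 2 (hne y))).congr_deriv ?_
    refine div_eq_zero_iff.2 (Or.inl ?_)
    simp only [Nat.cast_ofNat, Nat.add_one_sub_one, pow_one]
    linear_combination (2 * w' y * w y) * hode y
  have hconst := is_const_of_deriv_eq_zero (fun y => (hder y).differentiableAt)
    (fun y => (hder y).deriv) y 0
  have hval : (w' 0 ^ 2 + 8 * w 0 ^ 3 + 4 * q) / w 0 ^ 2 = 4 * β := by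
    have := hne 0
    rw [h0]; field_simp; ring
  rw [hval, div_eq_iff (pow_ne_zero 2 (hne y))] at hconst
  linear_combination hconst

end EquivariantLift

section CharacteristicPolynomial

theorem charpoly_of_zero_diagonal {R : Type*} [CommRing R] (b c d f g h : R) :
    (!![0, b, c; d, 0, f; g, h, 0] : Matrix (Fin 3) (Fin 3) R).charpoly =
      X ^ 3 - C (b * d + c * g + f * h) * X - C (b * f * g + c * d * h) := by
  simp [Matrix.charpoly, Matrix.det_fin_three]
  ring

theorem conj_zpow_neg_three_mul (lam : Circle) (ψ : ℂ) :
    (starRingEnd ℂ) ((lam : ℂ) ^ (-3 : ℤ) * ψ) = (lam : ℂ) ^ 3 * (starRingEnd ℂ) ψ := by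
  rw [map_mul, map_zpow₀, ← Circle.coe_inv_eq_conj, Circle.coe_inv]
  simp [zpow_neg]

theorem ofReal_betaConst (a : ℝ) (ψ : ℂ) :
    (betaConst a ψ : ℂ) = 2 * a + ψ * (starRingEnd ℂ) ψ / a ^ 2 := by
  rw [Complex.mul_conj', betaConst]; push_cast; rfl

theorem charpoly_potential {a : ℝ} (ha : 0 < a) (ψ : ℂ) (lam : Circle) :
    (potential a ψ lam).charpoly = X ^ 3 + C (betaConst a ψ : ℂ) * X
      - C (I * (2 * ((lam : ℂ) ^ (-3 : ℤ) * ψ).re : ℝ)) := by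
  have hlam : (lam : ℂ) ≠ 0 := Circle.coe_ne_zero lam
  have ha' : (a : ℂ) ≠ 0 := ofReal_ne_zero.2 ha.ne'
  have hsqrt : (√a : ℂ) * √a = a := by exact_mod_cast Real.mul_self_sqrt ha.le
  have hzpow : (lam : ℂ) ^ (-3 : ℤ) = (lam : ℂ)⁻¹ ^ 3 := by
    rw [zpow_neg, inv_pow]; norm_cast
  have hlinear : -I * lam * (starRingEnd ℂ) ψ * (a : ℂ)⁻¹ * (-I * (lam : ℂ)⁻¹ * ψ * (a : ℂ)⁻¹)
      + I * (lam : ℂ)⁻¹ * √a * (I * lam * √a) + I * lam * √a * (I * (lam : ℂ)⁻¹ * √a)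
      = -(betaConst a ψ : ℂ) := by
    rw [ofReal_betaConst]
    field_simp
    linear_combination ((starRingEnd ℂ) ψ * ψ + 2 * a ^ 2 * (√a * √a)) * I_sq - 2 * a ^ 2 * hsqrt
  have hconst : -I * lam * (starRingEnd ℂ) ψ * (a : ℂ)⁻¹ * (I * lam * √a) * (I * lam * √a)
      + I * (lam : ℂ)⁻¹ * √a * (-I * (lam : ℂ)⁻¹ * ψ * (a : ℂ)⁻¹) * (I * (lam : ℂ)⁻¹ * √a)
      = I * (2 * ((lam : ℂ) ^ (-3 : ℤ) * ψ).re : ℝ) := by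
    rw [← Complex.add_conj, conj_zpow_neg_three_mul, hzpow]
    field_simp
    linear_combination (-(lam ^ 6 * (starRingEnd ℂ) ψ + ψ)) * ((√a * √a) * I_sq - hsqrt)
  rw [potential, charpoly_of_zero_diagonal, hlinear, hconst, C_neg]
  ring

theorem eigenvalue_relations {β s : ℝ} {d₁ d₂ d₃ : ℝ}
    (hd : (X ^ 3 + C (β : ℂ) * X - C (I * (s : ℂ))) =
      (X - C (I * (d₁ : ℂ))) * (X - C (I * (d₂ : ℂ))) * (X - C (I * (d₃ : ℂ)))) :
    d₁ + d₂ + d₃ = 0 ∧ d₁ * d₂ + d₁ * d₃ + d₂ * d₃ = -β ∧ d₁ * d₂ * d₃ = -s := by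
  have hcubic : ∀ μ : ℂ, μ ^ 3 + β * μ - I * s = (μ - I * d₁) * (μ - I * d₂) * (μ - I * d₃) :=
    fun μ => by simpa using congrArg (Polynomial.eval μ) hd
  refine ⟨?_, ?_, ?_⟩ <;> refine ofReal_injective ?_ <;> push_cast
  · refine mul_left_cancel₀ I_ne_zero ?_
    linear_combination (1 / 2) * hcubic 1 + (1 / 2) * hcubic (-1) - hcubic 0
  · linear_combination (1 / 2) * hcubic 1 - (1 / 2) * hcubic (-1)
      + (d₁ * d₂ + d₁ * d₃ + d₂ * d₃ : ℂ) * I_sq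
  · refine mul_left_cancel₀ I_ne_zero ?_
    linear_combination (d₁ * d₂ * d₃ : ℂ) * Complex.I_pow_three - hcubic 0

end CharacteristicPolynomial

section Modes

variable {F : ℂ → Fin 3 → ℂ} {e : ℂ → ℝ} {Ψ : ℂ → ℂ}

/-- The frame `(F_z, F_z̄, F)` at the point `z`, as a basis of `ℂ³`. -/
noncomputable def IsMinimalLift.frameBasis (h : IsMinimalLift F e Ψ) (z : ℂ) :
    Module.Basis (Fin 3) ℂ (Fin 3 → ℂ) :=
  basisOfLinearIndependentOfCardEqFinrank
    (linearIndependent_of_herm (h.herm_frame z) (h.herm_frame_ne_zero z)) (by simp)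

theorem IsMinimalLift.frameBasis_apply (h : IsMinimalLift F e Ψ) (z : ℂ) (i : Fin 3) :
    h.frameBasis z i = frame F z i := by
  simp [frameBasis]

theorem IsMinimalLift.differentiable_frame (h : IsMinimalLift F e Ψ) (i : Fin 3) :
    Differentiable ℝ fun z => frame F z i := by
  fin_cases i
  exacts [h.differentiable_wz, h.differentiable_wzbar, h.differentiable]

theorem frame_translate {S : (Fin 3 → ℂ) →L[ℂ] (Fin 3 → ℂ)} {t : ℂ} (hF : Differentiable ℝ F)
    (hS : ∀ z, F (t + z) = S (F z)) (z : ℂ) (i : Fin 3) : frame F (t + z) i = S (frame F z i) := by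
  fin_cases i
  exacts [wz_translate hF hS z, wzbar_translate hF hS z, hS z]

namespace IsEquivariantLift

/-- The infinitesimal real translation: the linear map of `ℂ³` sending the frame at the origin to
its derivative along the real axis. By equivariance it generates the translations on all of `ℂ`. -/
noncomputable def generator (h : IsEquivariantLift F e Ψ) : (Fin 3 → ℂ) →ₗ[ℂ] (Fin 3 → ℂ) :=
  (h.frameBasis 0).constr ℂ fun i => fderiv ℝ (fun z => frame F z i) 0 1

theorem fderiv_one_eq_generator (h : IsEquivariantLift F e Ψ) (z : ℂ) :
    fderiv ℝ F z 1 = h.generator (F z) := by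
  set c := (h.frameBasis 0).repr (F z)
  have hF : ∀ t : ℝ, F (t * 1 + z) = ∑ i, c i • frame F (t * 1 + 0) i := fun t => by
    obtain ⟨S, -, hS⟩ := h.translator t
    simp only [mul_one, hS, frame_translate h.differentiable hS, ← map_smul, ← map_sum]
    simpa only [h.frameBasis_apply] using congrArg S ((h.frameBasis 0).sum_repr (F z)).symm
  have hder : HasDerivAt (fun t : ℝ => F (t * 1 + z))
      (∑ i, c i • fderiv ℝ (fun z => frame F z i) 0 1) 0 := by
    rw [funext hF]
    refine HasDerivAt.fun_sum fun i _ => ?_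
    simpa using (hasDerivAt_line (h.differentiable_frame i) 0 1 0).fun_const_smul (c i)
  rw [generator, Module.Basis.constr_apply_fintype]
  simpa using (hasDerivAt_line h.differentiable z 1 0).unique hder

theorem charpoly_generator (h : IsEquivariantLift F e Ψ) (h0 : fderiv ℝ e 0 I = 0) :
    h.generator.charpoly = X ^ 3 + C (betaConst (e 0) (Ψ 0) : ℂ) * X
      - C ((starRingEnd ℂ) (Ψ 0) - Ψ 0) := by
  have ha := h.metric_ne_zero 0
  have hmatrix : h.generator = Matrix.toLin (h.frameBasis 0) (h.frameBasis 0)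
      !![0, -(starRingEnd ℂ) (Ψ 0) / e 0, 1; Ψ 0 / e 0, 0, 1; -e 0, -e 0, 0] := by
    refine (h.frameBasis 0).ext fun i => ?_
    rw [generator, Module.Basis.constr_basis, Matrix.toLin_self, Fin.sum_univ_three]
    simp only [h.frameBasis_apply, fderiv_one_eq]
    fin_cases i <;>
      simp [frame, h.wz_wz, h.wzbar_wz, h.wz_wzbar, h.wzbar_wzbar, h.wz_metric, h.wzbar_metric,
        h0, add_comm]
  rw [hmatrix, Matrix.charpoly_toLin, charpoly_of_zero_diagonal, ofReal_betaConst]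
  have hlinear : -(starRingEnd ℂ) (Ψ 0) / e 0 * (Ψ 0 / e 0) + 1 * -(e 0 : ℂ) + 1 * -(e 0 : ℂ) =
      -(2 * e 0 + Ψ 0 * (starRingEnd ℂ) (Ψ 0) / e 0 ^ 2) := by field_simp; ring
  have hconst : -(starRingEnd ℂ) (Ψ 0) / e 0 * 1 * -(e 0 : ℂ) + 1 * (Ψ 0 / e 0) * -(e 0 : ℂ) =
      (starRingEnd ℂ) (Ψ 0) - Ψ 0 := by field_simp; ring
  rw [hlinear, hconst, C_neg]
  ring

end IsEquivariantLift

/-- The functional `L` is a mode of frequency `d`: along every real line, `L ∘ F` is a multiple of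
the character `x ↦ exp (i d x)`. -/
def IsMode (F : ℂ → Fin 3 → ℂ) (d : ℝ) (L : (Fin 3 → ℂ) →L[ℂ] ℂ) : Prop :=
  ∀ z, L (fderiv ℝ F z 1) = I * d * L (F z)

/-- The functionals `L j` are modes of frequencies `d j` and form a basis of the dual of `ℂ³`. -/
structure IsModeBasis (F : ℂ → Fin 3 → ℂ) (d : Fin 3 → ℝ) (L : Fin 3 → (Fin 3 → ℂ) →L[ℂ] ℂ) :
    Prop where
  isMode : ∀ j, IsMode F (d j) (L j)
  ne_zero : ∀ j, L j ≠ 0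
  separating : ∀ V, (∀ j, L j V = 0) → V = 0

theorem IsEquivariantLift.exists_isModeBasis (h : IsEquivariantLift F e Ψ) {d : Fin 3 → ℝ}
    (hd : Function.Injective d) (hroot : ∀ j, h.generator.charpoly.IsRoot (I * d j)) :
    ∃ L, IsModeBasis F d L := by
  choose v hv using fun j =>
    ((Module.End.hasEigenvalue_iff_isRoot_charpoly _ _).2 (hroot j)).exists_hasEigenvector
  let B := basisOfLinearIndependentOfCardEqFinrank
    (Module.End.eigenvectors_linearIndependent' h.generator (fun j => I * d j)
      ((mul_right_injective₀ I_ne_zero).comp (ofReal_injective.comp hd)) v hv) (by simp)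
  have hB : ∀ j, h.generator (B j) = (I * d j) • B j := fun j => by
    simpa [B] using (hv j).apply_eq_smul
  have hcoord : ∀ j, B.coord j ∘ₗ h.generator = (I * d j) • B.coord j := fun j => by
    refine B.ext fun k => ?_
    by_cases hjk : k = j <;> simp [hB, hjk]
  refine ⟨fun j => (B.coord j).toContinuousLinearMap, fun j z => ?_, fun j hj => ?_,
    fun V hV => B.repr.map_eq_zero_iff.1 (Finsupp.ext hV)⟩
  · rw [h.fderiv_one_eq_generator]
    exact LinearMap.congr_fun (hcoord j) (F z)
  · simpa using congrArg (fun L : (Fin 3 → ℂ) →L[ℂ] ℂ => L (B j)) hj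

namespace IsMode

variable {d : ℝ} {L : (Fin 3 → ℂ) →L[ℂ] ℂ}

theorem apply_translate (hL : IsMode F d L) (hF : Differentiable ℝ F) (x : ℝ) (z : ℂ) :
    L (F (x + z)) = exp (I * d * x) * L (F z) := by
  have hder : ∀ x : ℝ, HasDerivAt (fun x : ℝ => exp (-(I * d * x)) * L (F (x * 1 + z))) 0 x := by
    intro x
    have hLF : HasDerivAt (fun x : ℝ => L (F (x * 1 + z))) (L (fderiv ℝ F (x * 1 + z) 1)) x :=
      (L.restrictScalars ℝ).hasFDerivAt.comp_hasDerivAt x (hasDerivAt_line hF z 1 x)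
    have hexp := ((Complex.ofRealCLM.hasDerivAt (x := x)).const_mul (I * (d : ℂ))).fun_neg.cexp
    refine (hexp.mul hLF).congr_deriv ?_
    rw [hL]
    simp only [ofRealCLM_apply, ofReal_one]
    ring
  have hconst := is_const_of_deriv_eq_zero (fun y => (hder y).differentiableAt)
    (fun y => (hder y).deriv) x 0
  simp only [mul_one, ofReal_zero, mul_zero, neg_zero, Complex.exp_zero, zero_add, one_mul]
    at hconst
  rw [← hconst, ← mul_assoc, ← Complex.exp_add, add_neg_cancel, Complex.exp_zero, one_mul]

theorem fderiv_fderiv_one (hL : IsMode F d L) (hF : ContDiff ℝ ∞ F) (z : ℂ) :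
    L (fderiv ℝ (fun z => fderiv ℝ F z 1) z 1) = -d ^ 2 * L (F z) := by
  rw [← fderiv_clm_comp L ((contDiff_fderiv_apply hF 1).differentiable (by simp) z),
    funext fun z => show L (fderiv ℝ F z 1) = ((I * d) • L) (F z) from hL z,
    fderiv_clm_comp _ (hF.differentiable (by simp) z), _root_.smul_apply, hL, smul_eq_mul]
  linear_combination (d : ℂ) ^ 2 * L (F z) * I_sq

theorem second_order (hL : IsMode F d L) (h : IsMinimalLift F e Ψ) (z : ℂ) :
    L (fderiv ℝ (fun z => fderiv ℝ F z I) z I) = ((d ^ 2 - 4 * e z : ℝ) : ℂ) * L (F z) := by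
  have hlaplace := congrArg L (fderiv_fderiv_one_add_fderiv_fderiv_I h.smooth z)
  rw [map_add, hL.fderiv_fderiv_one h.smooth, h.wzbar_wz, map_smul, map_smul] at hlaplace
  push_cast
  simp only [smul_eq_mul] at hlaplace
  linear_combination hlaplace

theorem first_order (hL : IsMode F d L) (h : IsEquivariantLift F e Ψ) (z : ℂ) :
    L (fderiv ℝ F z I) * (I * (Ψ z + (starRingEnd ℂ) (Ψ z)) - (fderiv ℝ e z I : ℝ)) =
      L (F z) * (4 * (e z : ℂ) ^ 2 - 2 * d ^ 2 * e z - I * d * (Ψ z - (starRingEnd ℂ) (Ψ z))) := by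
  have he := h.metric_ne_zero z
  have hx := hL z
  have hxx := hL.fderiv_fderiv_one h.smooth z
  rw [MinLag.fderiv_fderiv_one h.smooth, h.wz_wz, h.wzbar_wzbar, h.wzbar_wz, h.wz_metric,
    h.wzbar_metric] at hxx
  rw [fderiv_one_eq] at hx
  rw [fderiv_I_eq]
  simp only [map_add, map_sub, map_smul, smul_eq_mul] at hxx hx ⊢
  field_simp at hxx
  linear_combination hxx - (Ψ z - (starRingEnd ℂ) (Ψ z)) * hx +
    (L (wz F z) - L (wzbar F z)) * (Ψ z + (starRingEnd ℂ) (Ψ z)) * I_sq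

theorem exists_apply_ne_zero (hL : IsMode F d L) (h : IsMinimalLift F e Ψ) (hL0 : L ≠ 0) :
    ∃ y : ℝ, L (F (y * I)) ≠ 0 := by
  by_contra! hy
  have hLF : (fun z => L (F z)) = fun _ => 0 := funext fun z => by
    rw [← re_add_im z, hL.apply_translate h.differentiable, hy, mul_zero]
  refine hL0 (ContinuousLinearMap.coe_injective ((h.frameBasis 0).ext fun i => ?_))
  rw [h.frameBasis_apply]
  fin_cases i
  · simpa [hLF, frame] using (wz_clm_comp L (h.differentiable 0)).symm
  · simpa [hLF, frame] using (wzbar_clm_comp L (h.differentiable 0)).symm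
  · exact congrFun hLF 0

end IsMode

end Modes

section Multipliers

theorem apply_add_zsmul {A K : Type*} [AddGroup A] [GroupWithZero K] {G : A → K} {w : A} {ν : K}
    (hν : ν ≠ 0) (hG : ∀ z, G (z + w) = ν * G z) (m : ℤ) (z : A) :
    G (z + m • w) = ν ^ m * G z := by
  induction m using Int.induction_on with
  | zero => simp
  | succ n ih => rw [add_one_zsmul, ← add_assoc, hG, ih, ← mul_assoc, add_comm, zpow_one_add₀ hν]
  | pred n ih =>
    rw [← mul_right_inj' hν, ← hG, add_assoc, ← add_one_zsmul, sub_add_cancel, ih, ← mul_assoc,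
      ← zpow_one_add₀ hν, add_sub_cancel]

section Bounded

variable {A K : Type*} [AddGroup A] [NormedField K] {G : A → K} {C : ℝ}

theorem norm_multiplier_le_one (hC : ∀ z, ‖G z‖ ≤ C) {w : A} {ν : K}
    (hG : ∀ z, G (z + w) = ν * G z) {z : A} (hz : G z ≠ 0) : ‖ν‖ ≤ 1 := by
  by_contra! hν
  obtain ⟨n, hn⟩ := pow_unbounded_of_one_lt (C / ‖G z‖) hν
  rw [div_lt_iff₀ (norm_pos_iff.2 hz)] at hn
  have hbound := hC (z + (n : ℤ) • w)
  rw [apply_add_zsmul (norm_pos_iff.1 (one_pos.trans hν)) hG, norm_mul, zpow_natCast,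
    norm_pow] at hbound
  exact hbound.not_gt hn

theorem norm_multiplier_eq_one (hC : ∀ z, ‖G z‖ ≤ C) {w : A} {ν : K}
    (hG : ∀ z, G (z + w) = ν * G z) {z : A} (hz : G z ≠ 0) : ‖ν‖ = 1 := by
  have hshift : ∀ z, ν * G (z + -w) = G z := fun z => by rw [← hG, neg_add_cancel_right]
  have hν : ν ≠ 0 := left_ne_zero_of_mul ((hshift z).trans_ne hz)
  have hinv := norm_multiplier_le_one hC (fun z => (eq_inv_mul_iff_mul_eq₀ hν).2 (hshift z)) hz
  rw [norm_inv] at hinv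
  exact (norm_multiplier_le_one hC hG hz).antisymm
    ((inv_le_one₀ (norm_pos_iff.2 hν)).1 hinv)

end Bounded

variable {F : ℂ → Fin 3 → ℂ} {e : ℂ → ℝ} {Ψ : ℂ → ℂ} {f : ℂ → CP2}

theorem IsMinimalLift.norm_clm_apply_le (h : IsMinimalLift F e Ψ) (L : (Fin 3 → ℂ) →L[ℂ] ℂ)
    (z : ℂ) : ‖L (F z)‖ ≤ ‖L‖ :=
  L.unit_le_opNorm _
    ((pi_norm_le_iff_of_nonneg zero_le_one).2 fun k => norm_apply_le_one (h.norm_one z) k)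

theorem IsMode.apply_add_imag {d : ℝ} {L : (Fin 3 → ℂ) →L[ℂ] ℂ} (hL : IsMode F d L)
    (hF : Differentiable ℝ F) {P : ℝ} {ν : ℂ}
    (hν : ∀ y : ℝ, L (F ((y + P : ℝ) * I)) = ν * L (F (y * I))) (z : ℂ) :
    L (F (z + P * I)) = ν * L (F z) := by
  rw [← re_add_im z, add_assoc, ← add_mul, ← ofReal_add, hL.apply_translate hF,
    hL.apply_translate hF, hν, mul_left_comm]

namespace IsModeBasis

variable {d : Fin 3 → ℝ} {L : Fin 3 → (Fin 3 → ℂ) →L[ℂ] ℂ}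

theorem translation_closes_iff (hL : IsModeBasis F d L) (h : IsMinimalLift F e Ψ)
    (hl : IsLift F f) {w : ℂ} {ν : Fin 3 → ℂ} (hν : ∀ j z, L j (F (z + w)) = ν j * L j (F z)) :
    (∀ z, f (z + w) = f z) ↔ ∀ j k, ν j = ν k := by
  simp only [hl.apply_eq_iff hl]
  refine ⟨fun hw => ?_, fun hν' z => ⟨ν 0, sub_eq_zero.1 (hL.separating _ fun j => ?_)⟩⟩
  · obtain ⟨c, -, hc⟩ := horizontal_lift_unique h.differentiable
      (H := fun z => F (z + w)) (h.differentiable.comp (differentiable_id.add_const w)) h.norm_one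
      (fun z => h.norm_one _) h.herm_fderiv
      (fun z v => by simpa only [fderiv_comp_add_right] using h.herm_fderiv (z + w) v) hw
    have hνc : ∀ j, ν j = c := fun j => by
      obtain ⟨y, hy⟩ := (hL.isMode j).exists_apply_ne_zero h (hL.ne_zero j)
      refine mul_right_cancel₀ hy ?_
      rw [← hν, ← smul_eq_mul c, ← map_smul, ← hc]
    exact fun j k => (hνc j).trans (hνc k).symm
  · rw [map_sub, hν, map_smul, hν' j 0, smul_eq_mul, sub_self]

end IsModeBasis

end Multipliers

section Arithmetic

theorem exp_I_mul_eq_iff (x y : ℝ) :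
    exp (I * x) = exp (I * y) ↔ ∃ n : ℤ, x - y = 2 * Real.pi * n := by
  rw [Complex.exp_eq_exp_iff_exists_int]
  refine exists_congr fun n => ?_
  rw [show I * y + n * (2 * Real.pi * I) = I * ((y + 2 * Real.pi * n : ℝ) : ℂ) by push_cast; ring,
    mul_right_inj' I_ne_zero, ofReal_inj, sub_eq_iff_eq_add']

theorem exists_int_multiple_of_rat {ι : Type*} [Finite ι] (r : ι → ℚ) :
    ∃ m : ℤ, m ≠ 0 ∧ ∀ j, ∃ n : ℤ, (m : ℝ) * r j = n := by
  obtain ⟨m, hm⟩ := IsLocalization.exist_integer_multiples_of_finite (nonZeroDivisors ℤ) r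
  refine ⟨m, nonZeroDivisors.ne_zero m.2, fun j => ?_⟩
  obtain ⟨n, hn⟩ := hm j
  rw [zsmul_eq_mul, eq_intCast] at hn
  exact ⟨n, by exact_mod_cast hn.symm⟩

/-- Summing the congruences `m θ j ≡ m θ k` over `k` makes `card ι · m · θ j` a multiple of `c`. -/
theorem exists_congruent_multiples_iff {ι : Type*} [Fintype ι] {θ : ι → ℝ} {c : ℝ}
    (hsum : ∑ j, θ j = 0) :
    (∃ m : ℤ, m ≠ 0 ∧ ∀ j k, ∃ n : ℤ, m * θ j - m * θ k = c * n) ↔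
      ∀ j, ∃ r : ℚ, θ j = c * r := by
  constructor
  · rintro ⟨m, hm, hθ⟩ j
    choose n hn using hθ j
    have hcard : (Fintype.card ι : ℝ) ≠ 0 := by
      exact_mod_cast (Fintype.card_pos_iff.2 ⟨j⟩).ne'
    have hm' : (m : ℝ) ≠ 0 := by exact_mod_cast hm
    have htotal : Fintype.card ι * (m * θ j) = c * ∑ k, (n k : ℝ) := by
      rw [Finset.mul_sum, ← Finset.sum_congr rfl fun k _ => hn k, Finset.sum_sub_distrib,
        ← Finset.mul_sum (f := θ), hsum, mul_zero, sub_zero, Finset.sum_const, Finset.card_univ,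
        nsmul_eq_mul]
    refine ⟨(∑ k, n k : ℤ) / (Fintype.card ι * m), ?_⟩
    push_cast
    field_simp
    linear_combination htotal
  · intro hθ
    choose r hr using hθ
    obtain ⟨m, hm, hint⟩ := exists_int_multiple_of_rat r
    choose n hn using hint
    refine ⟨m, hm, fun j k => ⟨n j - n k, ?_⟩⟩
    push_cast
    rw [← hn, ← hn, hr, hr]
    ring

theorem forall_rat_multiple_iff {θ : Fin 3 → ℝ} {c : ℝ} (hsum : ∑ j, θ j = 0) :
    (∀ j, ∃ r : ℚ, θ j = c * r) ↔ (∃ r : ℚ, θ 0 = c * r) ∧ ∃ r : ℚ, θ 1 = c * r := by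
  refine ⟨fun hθ => ⟨hθ 0, hθ 1⟩, ?_⟩
  rintro ⟨⟨r, hr⟩, ⟨s, hs⟩⟩ j
  rw [Fin.sum_univ_three] at hsum
  fin_cases j
  exacts [⟨r, hr⟩, ⟨s, hs⟩, ⟨-r - s, by push_cast; linear_combination hsum - hr - hs⟩]

theorem exists_common_multiplier_iff {θ τ : Fin 3 → ℝ} (hsum : ∑ j, θ j = 0)
    (hτ : ∀ j k, τ j - τ k = θ k - θ j) :
    (∃ m : ℤ, m ≠ 0 ∧ ∀ j k, exp (I * τ j) ^ m = exp (I * τ k) ^ m) ↔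
      (∃ r : ℚ, θ 0 = 2 * Real.pi * r) ∧ ∃ r : ℚ, θ 1 = 2 * Real.pi * r := by
  have hpow : ∀ (m : ℤ) j, exp (I * τ j) ^ m = exp (I * (m * τ j : ℝ)) := fun m j => by
    rw [← Complex.exp_int_mul, mul_left_comm]; push_cast; rfl
  have hdiff : ∀ (m : ℤ) j k, m * τ j - m * τ k = m * θ k - m * θ j := fun m j k => by
    rw [← mul_sub, ← mul_sub, hτ]
  simp only [hpow, exp_I_mul_eq_iff, hdiff]
  rw [← forall_rat_multiple_iff hsum, ← exists_congruent_multiples_iff hsum]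
  exact exists_congr fun m => and_congr_right fun _ => forall_comm

theorem exists_real_period_iff {d : Fin 3 → ℝ} (hsum : ∑ j, d j = 0) (hd : d 1 ≠ 0) :
    (∃ p : ℝ, p ≠ 0 ∧ ∀ j k, exp (I * d j * p) = exp (I * d k * p)) ↔ ∃ q : ℚ, d 0 / d 1 = q := by
  have hscale : ∀ c : ℝ, ∑ j, d j * c = 0 := fun c => by rw [← Finset.sum_mul, hsum, zero_mul]
  have hexp : ∀ (p : ℝ) j, exp (I * d j * p) = exp (I * (d j * p : ℝ)) := fun p j => by
    rw [mul_assoc]; push_cast; rfl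
  simp only [hexp, exp_I_mul_eq_iff]
  constructor
  · rintro ⟨p, hp, hperiod⟩
    obtain ⟨⟨r, hr⟩, ⟨s, hs⟩⟩ := (forall_rat_multiple_iff (hscale p)).1
      ((exists_congruent_multiples_iff (hscale p)).1
        ⟨1, one_ne_zero, by simpa only [Int.cast_one, one_mul] using hperiod⟩)
    refine ⟨r / s, ?_⟩
    rw [← mul_div_mul_right _ _ hp, hr, hs, mul_div_mul_left _ _ Real.two_pi_pos.ne']
    push_cast; rfl
  · rintro ⟨q, hq⟩
    obtain ⟨m, hm, hcongr⟩ := (exists_congruent_multiples_iff (c := 2 * Real.pi)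
      (hscale (2 * Real.pi / d 1))).2 ((forall_rat_multiple_iff (hscale _)).2
        ⟨⟨q, by rw [← hq]; ring⟩, 1, by push_cast; field_simp⟩)
    refine ⟨m * (2 * Real.pi / d 1), by simp [hm, hd, Real.pi_ne_zero], fun j k => ?_⟩
    obtain ⟨n, hn⟩ := hcongr j k
    exact ⟨n, by linear_combination hn⟩

end Arithmetic

section FirstOrder

theorem eq_exp_integral_mul {a g : ℝ → ℂ} (ha : Continuous a)
    (hg : ∀ y, HasDerivAt g (a y * g y) y) (y₀ y : ℝ) :
    g y = exp (∫ s in y₀..y, a s) * g y₀ := by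
  have hder : ∀ y, HasDerivAt (fun y => exp (-∫ s in y₀..y, a s) * g y) 0 y := fun y =>
    ((ha.integral_hasStrictDerivAt y₀ y).hasDerivAt.fun_neg.cexp.mul (hg y)).congr_deriv (by ring)
  have hconst := is_const_of_deriv_eq_zero (fun y => (hder y).differentiableAt)
    (fun y => (hder y).deriv) y y₀
  simp only [intervalIntegral.integral_same, neg_zero, Complex.exp_zero, one_mul] at hconst
  rw [← hconst, ← mul_assoc, ← Complex.exp_add, add_neg_cancel, Complex.exp_zero, one_mul]

theorem apply_add_period_of_first_order {a g : ℝ → ℂ} {P : ℝ} (ha : Continuous a)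
    (hP : Function.Periodic a P) (hg : ∀ y, HasDerivAt g (a y * g y) y) (y : ℝ) :
    g (y + P) = exp (∫ s in (0 : ℝ)..P, a s) * g y := by
  rw [eq_exp_integral_mul ha hg y (y + P), hP.intervalIntegral_add_eq y 0, zero_add]

end FirstOrder

section SecondOrder

variable {c : ℝ → ℝ} {y₀ : ℝ}

theorem proportional_of_wronskian_eq_zero {A : Type*} [NormedCommRing A] [NormedAlgebra ℝ A]
    {g g' k k' : ℝ → A} (hc : Continuous c) (hg : ∀ y, HasDerivAt g (g' y) y)
    (hg' : ∀ y, HasDerivAt g' (c y • g y) y) (hk : ∀ y, HasDerivAt k (k' y) y)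
    (hk' : ∀ y, HasDerivAt k' (c y • k y) y) (hW : g y₀ * k' y₀ = k y₀ * g' y₀) (y : ℝ) :
    g y₀ * k y = k y₀ * g y := by
  refine sub_eq_zero.1 (congrFun (eq_zero_of_linear_second_order hc
    (g := fun y => g y₀ * k y - k y₀ * g y) (g' := fun y => g y₀ * k' y - k y₀ * g' y)
    (fun y => ((hk y).const_mul _).sub ((hg y).const_mul _))
    (fun y => (((hk' y).const_mul _).sub ((hg' y).const_mul _)).congr_deriv ?_)
    (y₀ := y₀) (sub_eq_zero.2 (mul_comm _ _)) (sub_eq_zero.2 hW)) y)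
  rw [mul_smul_comm, mul_smul_comm, smul_sub]

/-- The translate and the complex conjugate of `g` satisfy the same initial condition at `y₀` up to
a factor, so both are proportional to `g`. -/
theorem exists_real_multiplier {P ρ : ℝ} {g g' : ℝ → ℂ} (hc : Continuous c)
    (hP : Function.Periodic c P) (hg : ∀ y, HasDerivAt g (g' y) y)
    (hg' : ∀ y, HasDerivAt g' (c y • g y) y) (hρ : g' y₀ = ρ * g y₀)
    (hρP : g' (y₀ + P) = ρ * g (y₀ + P)) (hg0 : g ≠ 0) : ∃ μ : ℝ, ∀ y, g (y + P) = μ * g y := by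
  have hy₀ : g y₀ ≠ 0 := fun h0 =>
    hg0 (eq_zero_of_linear_second_order hc hg hg' h0 (by rw [hρ, h0, mul_zero]))
  have hshift := proportional_of_wronskian_eq_zero hc hg hg' (y₀ := y₀)
    (fun y => (hg (y + P)).comp_add_const y P)
    (fun y => ((hg' (y + P)).comp_add_const y P).congr_deriv (by rw [hP]))
    (by rw [hρ, hρP]; ring)
  have hconj := proportional_of_wronskian_eq_zero hc hg hg' (y₀ := y₀)
    (fun y => (hg y).star)
    (fun y => (hg' y).star.congr_deriv (by rw [star_smul, star_trivial]))
    (by rw [hρ, star_mul', ← starRingEnd_apply, conj_ofReal]; ring) (y₀ + P)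
  obtain ⟨μ, hμ⟩ : ∃ μ : ℝ, g (y₀ + P) / g y₀ = μ :=
    Complex.conj_eq_iff_real.1 <| by
      have hstar : (starRingEnd ℂ) (g y₀) ≠ 0 := (_root_.map_ne_zero _).2 hy₀
      rw [map_div₀, div_eq_div_iff hstar hy₀]
      simp only [starRingEnd_apply]
      linear_combination hconj
  exact ⟨μ, fun y => by rw [← hμ, div_mul_eq_mul_div, eq_div_iff hy₀, ← hshift y, mul_comm]⟩

end SecondOrder

section Constants

variable {a : ℝ} {ψ : ℂ}

theorem betaConst_eq_aTwo_sub_aThree (a : ℝ) (ψ : ℂ) :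
    betaConst a ψ = 2 * (a + aTwo a ψ - aThree a ψ) := by
  unfold aTwo aThree
  ring

theorem half_betaConst_sub_pos (ha : 0 < a) (hψ : ψ ≠ 0) : 0 < betaConst a ψ / 2 - a := by
  have hpos : 0 < ‖ψ‖ ^ 2 / a ^ 2 := by positivity
  unfold betaConst
  linarith

theorem aTwo_pos (ha : 0 < a) (hψ : ψ ≠ 0) : 0 < aTwo a ψ := by
  have hh := half_betaConst_sub_pos ha hψ
  unfold aTwo
  positivity

theorem aThree_pos (ha : 0 < a) (hψ : ψ ≠ 0) : 0 < aThree a ψ := by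
  have hh := half_betaConst_sub_pos ha hψ
  have hlt : betaConst a ψ / 2 - a
      < √((betaConst a ψ / 2 - a) ^ 2 + 4 * a * (betaConst a ψ / 2 - a)) :=
    Real.lt_sqrt_of_sq_lt (lt_add_of_pos_right _ (by positivity))
  unfold aThree
  linarith

theorem mul_aTwo_eq (ha : 0 < a) (hψ : ψ ≠ 0) :
    a * aTwo a ψ = (a + aTwo a ψ) * aThree a ψ := by
  have hh := half_betaConst_sub_pos ha hψ
  have hsq := Real.sq_sqrt (show 0 ≤ (betaConst a ψ / 2 - a) ^ 2
    + 4 * a * (betaConst a ψ / 2 - a) by positivity)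
  unfold aTwo aThree
  linear_combination -hsq / 4

theorem betaConst_lt_of_aTwo_lt (ha : 0 < a) (h : aTwo a ψ < a) : betaConst a ψ < 3 * a := by
  have hlt := Real.lt_sq_of_sqrt_lt (show √((betaConst a ψ / 2 - a) ^ 2
    + 4 * a * (betaConst a ψ / 2 - a)) < 2 * a - (betaConst a ψ / 2 - a) by
      unfold aTwo at h; linarith)
  nlinarith

/-- With `x = ‖ψ‖² / a²`, the difference of the two sides is `(a - x)² (8 a + x)`. -/
theorem lt_betaConst_pow_three (ha : 0 < a) (hβ : betaConst a ψ < 3 * a) :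
    27 * ‖ψ‖ ^ 2 < betaConst a ψ ^ 3 := by
  unfold betaConst at *
  have hx : 0 ≤ ‖ψ‖ ^ 2 / a ^ 2 := by positivity
  have hψ : ‖ψ‖ ^ 2 = ‖ψ‖ ^ 2 / a ^ 2 * a ^ 2 := by field_simp
  have hdiff : 0 < (a - ‖ψ‖ ^ 2 / a ^ 2) ^ 2 * (8 * a + ‖ψ‖ ^ 2 / a ^ 2) :=
    mul_pos (pow_pos (by linarith) 2) (by linarith)
  linear_combination hdiff + 27 * hψ

theorem halfPeriod_pos (ha : 0 < a) (hψ : ψ ≠ 0) : 0 < halfPeriod a ψ := by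
  have h₂ := aTwo_pos ha hψ
  have h₃ := aThree_pos ha hψ
  refine div_pos (ellipticJ_pos ?_ (by positivity)) (Real.sqrt_pos.2 (by positivity))
  rw [div_lt_one (by positivity)]
  linarith

theorem injective_of_eigenvalue_relations {d : Fin 3 → ℝ} {β s : ℝ} (hsum : d 0 + d 1 + d 2 = 0)
    (hpair : d 0 * d 1 + d 0 * d 2 + d 1 * d 2 = -β) (hprod : d 0 * d 1 * d 2 = -s)
    (hdisc : 27 * s ^ 2 < 4 * β ^ 3) : Function.Injective d := by
  have hvandermonde : 0 < ((d 0 - d 1) * (d 0 - d 2) * (d 1 - d 2)) ^ 2 := by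
    obtain rfl : β = -(d 0 * d 1 + d 0 * d 2 + d 1 * d 2) := by linarith
    obtain rfl : s = -(d 0 * d 1 * d 2) := by linarith
    have h2 : d 2 = -d 0 - d 1 := by linarith
    rw [h2] at hdisc ⊢
    linear_combination hdisc
  have hne := pow_ne_zero_iff two_ne_zero |>.1 hvandermonde.ne'
  simp only [ne_eq, mul_eq_zero, sub_eq_zero, not_or] at hne
  intro j k hjk
  fin_cases j <;> fin_cases k <;> first | rfl | simp_all

end Constants

/-- `v` solves the Gauss equation `(e^v)'' = 4 β e^v - 12 e^{2v}` of a translationally equivariant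
minimal Lagrangian surface, with critical point `0` and period `P`. -/
structure IsMetricProfile (β P : ℝ) (v : ℝ → ℝ) : Prop where
  differentiable : Differentiable ℝ v
  gauss : ∀ y, HasDerivAt (fun y => Real.exp (v y) * deriv v y)
    (4 * β * Real.exp (v y) - 12 * Real.exp (v y) ^ 2) y
  deriv_zero : deriv v 0 = 0
  periodic : Function.Periodic v P

namespace IsMetricProfile

variable {β P : ℝ} {v : ℝ → ℝ}

theorem continuous_exp_mul_deriv (h : IsMetricProfile β P v) :
    Continuous fun y => Real.exp (v y) * deriv v y :=
  continuous_iff_continuousAt.2 fun y => (h.gauss y).continuousAt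

theorem even (h : IsMetricProfile β P v) : Function.Even v := by
  have hw : ∀ y, HasDerivAt (fun y => Real.exp (v y)) (Real.exp (v y) * deriv v y) y := fun y =>
    (h.differentiable y).hasDerivAt.exp
  have hexp := metric_ode_unique (β := β) (w := fun y => Real.exp (v (-y)))
    (fun y => ((hw (-y)).scomp y (hasDerivAt_neg y)))
    (fun y => (((h.gauss (-y)).scomp y (hasDerivAt_neg y)).const_smul (-1 : ℝ)).congr_deriv
      (by simp))
    hw h.gauss (by simp) (by simp [h.deriv_zero])
  exact fun y => Real.exp_injective (congrFun hexp y)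

theorem reflect (h : IsMetricProfile β P v) (y : ℝ) : v (P - y) = v y := by
  rw [h.periodic.sub_eq', h.even]

theorem deriv_reflect (h : IsMetricProfile β P v) (y : ℝ) : deriv v (P - y) = -deriv v y := by
  rw [← neg_eq_iff_eq_neg, ← deriv_comp_const_sub, funext h.reflect]

theorem periodic_deriv (h : IsMetricProfile β P v) : Function.Periodic (deriv v) P := fun y => by
  rw [← deriv_comp_add_const, funext h.periodic]

theorem exists_deriv_ne_zero (h : IsMetricProfile β P v) (hβ : β ≠ 3 * Real.exp (v 0)) :
    ∃ y, deriv v y ≠ 0 := by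
  by_contra! hconst
  have hgauss := h.gauss 0
  simp only [hconst, mul_zero] at hgauss
  have hzero : 4 * Real.exp (v 0) * (β - 3 * Real.exp (v 0)) = 0 := by
    linear_combination hgauss.unique (hasDerivAt_const 0 0)
  exact hβ (sub_eq_zero.1 ((mul_eq_zero.1 hzero).resolve_left (by positivity)))

end IsMetricProfile

section Profile

variable {F : ℂ → Fin 3 → ℂ} {e : ℂ → ℝ} {Ψ : ℂ → ℂ}

theorem IsEquivariantLift.hasDerivAt_fderiv_metric (h : IsEquivariantLift F e Ψ)
    (h0 : fderiv ℝ e 0 I = 0) (y : ℝ) :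
    HasDerivAt (fun y : ℝ => fderiv ℝ e (y * I) I)
      (4 * betaConst (e 0) (Ψ 0) * e (y * I) - 12 * e (y * I) ^ 2) y := by
  have hgauss : ∀ y : ℝ, e (y * I) * fderiv ℝ (fun z => fderiv ℝ e z I) (y * I) I
      = fderiv ℝ e (y * I) I ^ 2 - 4 * e (y * I) ^ 3 + 4 * ‖Ψ 0‖ ^ 2 := fun y => by
    rw [h.gauss_translate, h.hopf_const]
  have hw' := hasDerivAt_imag
    ((contDiff_fderiv_apply h.contDiff_metric I).differentiable (by simp))
  have hfirst := metric_first_integral (β := betaConst (e 0) (Ψ 0)) (fun y => h.pos _)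
    (hasDerivAt_imag h.differentiable_metric) hw' hgauss (by
      have hpos := h.pos 0
      simp only [ofReal_zero, zero_mul, h0, betaConst]
      field_simp
      ring)
  refine (hw' y).congr_deriv (mul_left_cancel₀ (h.pos (y * I)).ne' ?_)
  rw [hgauss, hfirst]
  ring

variable {u : ℂ → ℝ}

theorem IsMinimalLift.differentiable_conformalFactor
    (h : IsMinimalLift F (fun z => Real.exp (u z)) Ψ) : Differentiable ℝ u := by
  simpa only [Real.log_exp] using h.differentiable_metric.log fun z => (Real.exp_pos (u z)).ne'

theorem IsMinimalLift.fderiv_exp_conformalFactor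
    (h : IsMinimalLift F (fun z => Real.exp (u z)) Ψ) (z : ℂ) :
    fderiv ℝ (fun z => Real.exp (u z)) z I = Real.exp (u z) * fderiv ℝ u z I := by
  rw [fderiv_exp (h.differentiable_conformalFactor z), _root_.smul_apply, smul_eq_mul]

theorem IsEquivariantLift.isMetricProfile
    (h : IsEquivariantLift F (fun z => Real.exp (u z)) Ψ) {ψ : ℂ} (hψ : ψ ≠ 0)
    (hnorm : ‖Ψ 0‖ = ‖ψ‖) (h0 : fderiv ℝ u 0 I = 0) :
    IsMetricProfile (betaConst (Real.exp (u 0)) ψ) (2 * halfPeriod (Real.exp (u 0)) ψ)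
      (fun y : ℝ => u (y * I)) := by
  have hv := hasDerivAt_imag h.differentiable_conformalFactor
  have hexp := h.fderiv_exp_conformalFactor
  have hβ : betaConst (Real.exp (u 0)) (Ψ 0) = betaConst (Real.exp (u 0)) ψ := by
    rw [betaConst, hnorm, betaConst]
  have hw : ∀ y : ℝ, HasDerivAt (fun y : ℝ => Real.exp (u (y * I)))
      (Real.exp (u (y * I)) * fderiv ℝ u (y * I) I) y := fun y => (hv y).exp
  have hw' := h.hasDerivAt_fderiv_metric (by rw [hexp, h0, mul_zero])
  simp only [hexp, hβ] at hw'
  have ha := Real.exp_pos (u 0)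
  have ha₂ := aTwo_pos ha hψ
  have ha₃ := aThree_pos ha hψ
  have hper := periodic_of_metric_ode (add_pos ha ha₃) (add_pos ha₂ ha₃)
    (betaConst_eq_aTwo_sub_aThree _ _) (mul_aTwo_eq ha hψ) hw hw' (by simp) (by simp [h0])
  refine ⟨fun y => (hv y).differentiableAt, ?_, ?_, fun y => Real.exp_injective (hper y)⟩
  · simpa only [(hv _).deriv] using hw'
  · rw [(hv 0).deriv, ofReal_zero, zero_mul, h0]

end Profile

section PrincipalValue

variable {k den : ℝ → ℂ} {P ε : ℝ}

theorem measurableSet_truncation (hcont : Continuous den) (P ε : ℝ) :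
    MeasurableSet {s : ℝ | s ∈ Set.Ioc 0 P ∧ ε < ‖den s‖} :=
  measurableSet_Ioc.inter (measurableSet_lt measurable_const hcont.norm.measurable)

theorem setIntegral_truncation_eq_zero_of_odd (hε : 0 < ε) (hcont : Continuous den)
    (h0 : den 0 = 0) (hden : ∀ s, den (P - s) = -den s) (hk : ∀ s, k (P - s) = -k s) :
    ∫ s in {s : ℝ | s ∈ Set.Ioc 0 P ∧ ε < ‖den s‖}, k s = 0 := by
  set A : Set ℝ := {s : ℝ | s ∈ Set.Ioc 0 P ∧ ε < ‖den s‖}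
  have hP : den P = 0 := by rw [← sub_zero P, hden, h0, neg_zero]
  have hreflect : ∀ s ∈ A, P - s ∈ A := by
    rintro s ⟨⟨hs0, hsP⟩, hs⟩
    have hne : s ≠ P := by
      rintro rfl
      rw [hP, norm_zero] at hs
      exact hε.not_gt hs
    exact ⟨⟨sub_pos.2 (hsP.lt_of_ne hne), by linarith⟩, by rwa [hden, norm_neg]⟩
  have hmem : ∀ s, P - s ∈ A ↔ s ∈ A := fun s =>
    ⟨fun hs => by simpa using hreflect _ hs, hreflect s⟩
  have hodd : ∀ s, A.indicator k (P - s) = -A.indicator k s := fun s => by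
    by_cases hs : s ∈ A
    · rw [Set.indicator_of_mem hs, Set.indicator_of_mem ((hmem s).2 hs), hk]
    · rw [Set.indicator_of_notMem hs, Set.indicator_of_notMem (mt (hmem s).1 hs), neg_zero]
  have hint := integral_sub_left_eq_self (A.indicator k) volume P
  simp only [hodd, integral_neg] at hint
  rw [← integral_indicator (measurableSet_truncation hcont P ε)]
  exact self_eq_neg.1 hint.symm

theorem hasPrincipalValue_zero_of_odd (hcont : Continuous den) (h0 : den 0 = 0)
    (hden : ∀ s, den (P - s) = -den s) (hk : ∀ s, k (P - s) = -k s) :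
    HasPrincipalValue k den P 0 :=
  tendsto_const_nhds.congr' <| by
    filter_upwards [self_mem_nhdsWithin] with ε hε
    exact (setIntegral_truncation_eq_zero_of_odd hε hcont h0 hden hk).symm

/-- The odd summand integrates to zero over every truncation, which leaves `c` times the length of
the truncation. -/
theorem exists_hasPrincipalValue_const_add_odd (c b : ℂ) (hcont : Continuous den) (h0 : den 0 = 0)
    (hden : ∀ s, den (P - s) = -den s) (hk : ∀ s, den s ≠ 0 → k s = c + b / den s) :
    ∃ V : ℝ, HasPrincipalValue k den P (V * c) := by
  set A : ℝ → Set ℝ := fun ε => {s : ℝ | s ∈ Set.Ioc 0 P ∧ ε < ‖den s‖}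
  have hfinite : ∀ ε, volume (A ε) ≠ ⊤ := fun ε =>
    ((measure_mono fun s hs => hs.1).trans_lt measure_Ioc_lt_top).ne
  have hanti : Antitone fun ε => volume.real (A ε) := fun ε ε' hle =>
    measureReal_mono (fun s hs => ⟨hs.1, hle.trans_lt hs.2⟩) (hfinite _)
  refine ⟨_, (((Complex.continuous_ofReal.tendsto _).comp
    (hanti.tendsto_nhdsGT 0)).mul_const c).congr' ?_⟩
  filter_upwards [self_mem_nhdsWithin] with ε (hε : 0 < ε)
  have hmeas := measurableSet_truncation hcont P ε
  have hint : IntegrableOn (fun s => b / den s) (A ε) :=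
    Measure.integrableOn_of_bounded (M := ‖b‖ / ε) (hfinite ε)
      (measurable_const.div hcont.measurable).aestronglyMeasurable <|
      (ae_restrict_iff' hmeas).2 <| Eventually.of_forall fun s hs => by
        rw [norm_div]
        exact div_le_div_of_nonneg_left (norm_nonneg _) hε hs.2.le
  have hodd : ∫ s in A ε, b / den s = 0 :=
    setIntegral_truncation_eq_zero_of_odd hε hcont h0 hden fun s => by rw [hden, div_neg]
  have hconst : IntegrableOn (fun _ => c) (A ε) := integrableOn_const (hfinite ε)
  calc (volume.real (A ε) : ℂ) * c
      = (∫ _ in A ε, c) + ∫ s in A ε, b / den s := by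
        rw [hodd, setIntegral_const, add_zero, real_smul]
    _ = ∫ s in A ε, (c + b / den s) := (integral_add hconst hint).symm
    _ = ∫ s in A ε, k s :=
        setIntegral_congr_fun hmeas fun s hs =>
          (hk s (norm_pos_iff.1 (hε.trans hs.2))).symm

end PrincipalValue

section Phase

variable {v : ℝ → ℝ} {ψ : ℂ} {lam : Circle} {β P : ℝ}

theorem betaDen_eq (v : ℝ → ℝ) (ψ : ℂ) (lam : Circle) (s : ℝ) :
    betaDen v ψ lam s = -(2 * ((lam : ℂ) ^ (-3 : ℤ) * ψ).im : ℝ) * I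
      - (Real.exp (v s) * deriv v s : ℝ) := by
  rw [betaDen, ← conj_zpow_neg_three_mul, ← neg_sub (((lam : ℂ) ^ (-3 : ℤ) * ψ)), Complex.sub_conj]
  ring

theorem betaDen_ne_zero (hp : ((lam : ℂ) ^ (-3 : ℤ) * ψ).im ≠ 0) (s : ℝ) :
    betaDen v ψ lam s ≠ 0 := fun h => by
  have him : (betaDen v ψ lam s).im = -(2 * ((lam : ℂ) ^ (-3 : ℤ) * ψ).im) := by
    rw [betaDen_eq, ← ofReal_neg, sub_im, im_ofReal_mul, I_im, mul_one, ofReal_im, sub_zero]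
  rw [h, zero_im] at him
  exact hp (by linarith)

theorem betaOneIntegrand_eq {s : ℝ} (hs : betaDen v ψ lam s ≠ 0) :
    betaOneIntegrand v ψ lam s
      = I + 2 * I * ((lam : ℂ) ^ (-3 : ℤ) * ψ).re / betaDen v ψ lam s := by
  have hre := Complex.add_conj ((lam : ℂ) ^ (-3 : ℤ) * ψ)
  rw [conj_zpow_neg_three_mul, ofReal_mul, ofReal_ofNat] at hre
  rw [betaOneIntegrand, div_eq_iff hs, add_mul, div_mul_cancel₀ _ hs, betaDen]
  push_cast
  linear_combination I * hre

/-- The logarithmic derivative along the `y`-axis of a mode of frequency `d`. Its denominator is the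
conjugate of the common denominator of the integrands of `β₁` and `β₂`. -/
noncomputable def modeRate (v : ℝ → ℝ) (ψ lam : ℂ) (d s : ℝ) : ℂ :=
  ((4 * Real.exp (v s) ^ 2 - 2 * d ^ 2 * Real.exp (v s)
      - 2 * d * (lam ^ (-3 : ℤ) * ψ).re : ℝ) : ℂ) / (starRingEnd ℂ) (betaDen v ψ lam s)

theorem modeRate_eq {s : ℝ} (hs : betaDen v ψ lam s ≠ 0) (d : ℝ) :
    modeRate v ψ lam d s = modeRate v ψ lam 0 s
      - d ^ 2 * (starRingEnd ℂ) (betaTwoIntegrand v ψ lam s)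
      - d * (I * (starRingEnd ℂ) (betaOneIntegrand v ψ lam s) - 1) := by
  have hs' : (starRingEnd ℂ) (betaDen v ψ lam s) ≠ 0 := (_root_.map_ne_zero _).2 hs
  rw [betaOneIntegrand_eq hs]
  simp only [modeRate, betaTwoIntegrand, map_add, map_mul, map_div₀, conj_I, conj_ofReal,
    Complex.conj_ofNat]
  generalize ((lam : ℂ) ^ (-3 : ℤ) * ψ).re = q
  generalize (starRingEnd ℂ) (betaDen v ψ lam s) = D at hs' ⊢
  push_cast
  field_simp
  linear_combination (-d * (2 * q + D)) * Complex.I_sq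

theorem exists_ofReal_eq_modeRate (hp : ((lam : ℂ) ^ (-3 : ℤ) * ψ).im = 0) (d s : ℝ) :
    ∃ ρ : ℝ, modeRate v ψ lam d s = ρ :=
  ⟨(4 * Real.exp (v s) ^ 2 - 2 * d ^ 2 * Real.exp (v s) - 2 * d * ((lam : ℂ) ^ (-3 : ℤ) * ψ).re) /
      -(Real.exp (v s) * deriv v s), by
    rw [modeRate, betaDen_eq, hp, mul_zero, ofReal_zero, neg_zero, zero_mul, zero_sub, map_neg,
      conj_ofReal, ← ofReal_neg, ← ofReal_div]⟩

namespace IsMetricProfile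

theorem continuous_betaDen (h : IsMetricProfile β P v) (ψ : ℂ) (lam : Circle) :
    Continuous (betaDen v ψ lam) :=
  continuous_const.sub (continuous_ofReal.comp h.continuous_exp_mul_deriv)

theorem continuous_betaOneIntegrand (h : IsMetricProfile β P v)
    (hp : ((lam : ℂ) ^ (-3 : ℤ) * ψ).im ≠ 0) : Continuous (betaOneIntegrand v ψ lam) := by
  rw [show betaOneIntegrand v ψ lam = _ from
    funext fun s => betaOneIntegrand_eq (betaDen_ne_zero hp s)]
  exact continuous_const.add
    (continuous_const.div (h.continuous_betaDen ψ lam) (betaDen_ne_zero hp))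

theorem continuous_betaTwoIntegrand (h : IsMetricProfile β P v)
    (hp : ((lam : ℂ) ^ (-3 : ℤ) * ψ).im ≠ 0) : Continuous (betaTwoIntegrand v ψ lam) :=
  have hv := h.differentiable.continuous
  Continuous.div (by fun_prop) (h.continuous_betaDen ψ lam) (betaDen_ne_zero hp)

theorem continuous_modeRate (h : IsMetricProfile β P v)
    (hp : ((lam : ℂ) ^ (-3 : ℤ) * ψ).im ≠ 0) (d : ℝ) : Continuous (modeRate v ψ lam d) :=
  have hv := h.differentiable.continuous
  Continuous.div (by fun_prop) (continuous_conj.comp (h.continuous_betaDen ψ lam))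
    fun s => (_root_.map_ne_zero _).2 (betaDen_ne_zero hp s)

theorem periodic_betaDen (h : IsMetricProfile β P v) (ψ lam : ℂ) :
    Function.Periodic (betaDen v ψ lam) P := fun s => by
  simp only [betaDen, h.periodic s, h.periodic_deriv s]

theorem periodic_modeRate (h : IsMetricProfile β P v) (ψ lam : ℂ) (d : ℝ) :
    Function.Periodic (modeRate v ψ lam d) P := fun s => by
  simp only [modeRate, h.periodic s, h.periodic_betaDen ψ lam s]

theorem integral_modeRate (h : IsMetricProfile β P v)
    (hp : ((lam : ℂ) ^ (-3 : ℤ) * ψ).im ≠ 0) (d : ℝ) :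
    ∫ s in (0 : ℝ)..P, modeRate v ψ lam d s = (∫ s in (0 : ℝ)..P, modeRate v ψ lam 0 s)
      - d ^ 2 * (starRingEnd ℂ) (betaTwo v ψ lam P)
      - d * (I * (starRingEnd ℂ) (betaOne v ψ lam P) - P) := by
  have hone : IntervalIntegrable (fun s => I * (starRingEnd ℂ) (betaOneIntegrand v ψ lam s))
      volume 0 P := ((h.continuous_betaOneIntegrand hp).star.const_mul I).intervalIntegrable 0 P
  have htwo : IntervalIntegrable
      (fun s => (d : ℂ) ^ 2 * (starRingEnd ℂ) (betaTwoIntegrand v ψ lam s)) volume 0 P :=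
    ((h.continuous_betaTwoIntegrand hp).star.const_mul _).intervalIntegrable 0 P
  have hrate : IntervalIntegrable (modeRate v ψ lam 0) volume 0 P :=
    (h.continuous_modeRate hp 0).intervalIntegrable 0 P
  simp only [modeRate_eq (betaDen_ne_zero hp _) d]
  rw [intervalIntegral.integral_sub (hrate.sub htwo)
      ((hone.sub intervalIntegrable_const).const_mul _),
    intervalIntegral.integral_sub hrate htwo, intervalIntegral.integral_const_mul,
    intervalIntegral.integral_const_mul,
    intervalIntegral.integral_sub hone intervalIntegrable_const,
    intervalIntegral.integral_const_mul, intervalIntegral.intervalIntegral_conj,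
    intervalIntegral.intervalIntegral_conj, intervalIntegral.integral_const, betaOne, betaTwo,
    sub_zero, real_smul, mul_one]

theorem im_integral_modeRate (h : IsMetricProfile β P v)
    (hp : ((lam : ℂ) ^ (-3 : ℤ) * ψ).im ≠ 0) (d : ℝ) :
    (∫ s in (0 : ℝ)..P, modeRate v ψ lam d s).im = (∫ s in (0 : ℝ)..P, modeRate v ψ lam 0 s).im
      - ((betaOne v ψ lam P).re * d - (betaTwo v ψ lam P).im * d ^ 2) := by
  rw [h.integral_modeRate hp]
  simp only [sub_im, im_ofReal_mul, ← ofReal_pow, I_mul_im, conj_re, conj_im, ofReal_im]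
  ring

theorem reflect_betaDen (h : IsMetricProfile β P v) (hp : ((lam : ℂ) ^ (-3 : ℤ) * ψ).im = 0)
    (s : ℝ) : betaDen v ψ lam (P - s) = -betaDen v ψ lam s := by
  rw [betaDen_eq, betaDen_eq, hp, h.reflect, h.deriv_reflect]
  push_cast
  ring

theorem betaDen_zero (h : IsMetricProfile β P v) (hp : ((lam : ℂ) ^ (-3 : ℤ) * ψ).im = 0) :
    betaDen v ψ lam 0 = 0 := by
  rw [betaDen_eq, hp, h.deriv_zero]
  simp

theorem exists_hasPrincipalValue_betaOne (h : IsMetricProfile β P v)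
    (hp : ((lam : ℂ) ^ (-3 : ℤ) * ψ).im = 0) :
    ∃ V : ℝ, HasPrincipalValue (betaOneIntegrand v ψ lam) (betaDen v ψ lam) P (V * I) :=
  exists_hasPrincipalValue_const_add_odd _ _ (h.continuous_betaDen ψ lam) (h.betaDen_zero hp)
    (h.reflect_betaDen hp) fun _ => betaOneIntegrand_eq

theorem hasPrincipalValue_betaTwo (h : IsMetricProfile β P v)
    (hp : ((lam : ℂ) ^ (-3 : ℤ) * ψ).im = 0) :
    HasPrincipalValue (betaTwoIntegrand v ψ lam) (betaDen v ψ lam) P 0 :=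
  hasPrincipalValue_zero_of_odd (h.continuous_betaDen ψ lam) (h.betaDen_zero hp)
    (h.reflect_betaDen hp) fun s => by
      rw [betaTwoIntegrand, h.reflect, h.reflect_betaDen hp, div_neg, betaTwoIntegrand]

end IsMetricProfile

end Phase

section ModesAlongImaginaryAxis

variable {F : ℂ → Fin 3 → ℂ} {e : ℂ → ℝ} {Ψ : ℂ → ℂ} {L : (Fin 3 → ℂ) →L[ℂ] ℂ} {d : ℝ}

theorem hasDerivAt_clm_imag (L : (Fin 3 → ℂ) →L[ℂ] ℂ) {G : ℂ → Fin 3 → ℂ}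
    (hG : Differentiable ℝ G) (y : ℝ) :
    HasDerivAt (fun y : ℝ => L (G (y * I))) (L (fderiv ℝ G (y * I) I)) y :=
  (L.restrictScalars ℝ).hasFDerivAt.comp_hasDerivAt y (hasDerivAt_imag hG y)

theorem IsMode.hasDerivAt_fderiv_imag (hL : IsMode F d L) (h : IsMinimalLift F e Ψ) (y : ℝ) :
    HasDerivAt (fun y : ℝ => L (fderiv ℝ F (y * I) I))
      ((d ^ 2 - 4 * e (y * I)) • L (F (y * I))) y := by
  rw [real_smul, ← hL.second_order h]
  exact hasDerivAt_clm_imag L ((contDiff_fderiv_apply h.smooth I).differentiable (by simp)) y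

variable {u : ℂ → ℝ} {ψ : ℂ} {lam : Circle}

theorem IsMode.fderiv_I_eq_modeRate_mul (hL : IsMode F d L)
    (h : IsEquivariantLift F (fun z => Real.exp (u z)) Ψ)
    (hΨ : Ψ 0 = -I * ((lam : ℂ) ^ (-3 : ℤ) * ψ)) {y : ℝ}
    (hy : betaDen (fun y : ℝ => u (y * I)) ψ lam y ≠ 0) :
    L (fderiv ℝ F (y * I) I)
      = modeRate (fun y : ℝ => u (y * I)) ψ lam d y * L (F (y * I)) := by
  have hfirst := hL.first_order h (y * I)
  have hexp : fderiv ℝ (fun z => Real.exp (u z)) (y * I) I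
      = Real.exp (u (y * I)) * deriv (fun y : ℝ => u (y * I)) y := by
    rw [h.fderiv_exp_conformalFactor, (hasDerivAt_imag h.differentiable_conformalFactor y).deriv]
  have hden : (starRingEnd ℂ) (betaDen (fun y : ℝ => u (y * I)) ψ lam y)
      = I * (Ψ 0 + (starRingEnd ℂ) (Ψ 0)) - (fderiv ℝ (fun z => Real.exp (u z)) (y * I) I : ℝ) := by
    rw [hexp, betaDen_eq, Complex.add_conj, hΨ, map_sub, map_mul, conj_I, ← ofReal_neg, conj_ofReal,
      conj_ofReal, neg_mul, neg_re, I_mul_re]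
    push_cast
    ring
  have hnum : -I * (Ψ 0 - (starRingEnd ℂ) (Ψ 0)) = -(2 * ((lam : ℂ) ^ (-3 : ℤ) * ψ).re : ℝ) := by
    have him : (-I * ((lam : ℂ) ^ (-3 : ℤ) * ψ)).im = -((lam : ℂ) ^ (-3 : ℤ) * ψ).re := by
      rw [neg_mul, neg_im, I_mul_im]
    rw [Complex.sub_conj, hΨ, him]
    push_cast
    linear_combination 2 * (((lam : ℂ) ^ (-3 : ℤ) * ψ).re : ℂ) * Complex.I_sq
  rw [modeRate, div_mul_eq_mul_div, eq_div_iff ((_root_.map_ne_zero _).2 hy), hden]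
  rw [h.hopf_const] at hfirst
  rw [ofReal_mul] at hnum
  simp only [ofReal_sub, ofReal_mul, ofReal_pow, ofReal_ofNat] at hnum ⊢
  linear_combination hfirst + d * L (F (y * I)) * hnum

end ModesAlongImaginaryAxis

section Assembly

variable {F : ℂ → Fin 3 → ℂ} {e : ℂ → ℝ} {Ψ : ℂ → ℂ} {f : ℂ → CP2} {ψ : ℂ} {lam : Circle}

theorem norm_neg_I_mul_zpow_mul (lam : Circle) (n : ℤ) (ψ : ℂ) :
    ‖-I * ((lam : ℂ) ^ n * ψ)‖ = ‖ψ‖ := by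
  rw [norm_mul, norm_neg, norm_I, one_mul, norm_mul, norm_zpow, Circle.norm_coe, one_zpow, one_mul]

theorem IsEquivariantLift.charpoly_generator_eq_charpoly_potential (h : IsEquivariantLift F e Ψ)
    (h0 : fderiv ℝ e 0 I = 0) (hΨ : Ψ 0 = -I * ((lam : ℂ) ^ (-3 : ℤ) * ψ)) :
    h.generator.charpoly = (potential (e 0) ψ lam).charpoly := by
  have hβ : betaConst (e 0) (Ψ 0) = betaConst (e 0) ψ := by
    rw [betaConst, hΨ, norm_neg_I_mul_zpow_mul, betaConst]
  have him : (Ψ 0).im = -((lam : ℂ) ^ (-3 : ℤ) * ψ).re := by rw [hΨ, neg_mul, neg_im, I_mul_im]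
  rw [h.charpoly_generator h0, charpoly_potential (h.pos 0), hβ, ← neg_sub (Ψ 0), Complex.sub_conj,
    him, mul_neg, ofReal_neg, neg_mul, neg_neg, mul_comm _ I]

theorem injective_of_charpoly_potential {a : ℝ} {d : Fin 3 → ℝ} (ha : 0 < a)
    (hβ : betaConst a ψ < 3 * a)
    (hd : (potential a ψ lam).charpoly
      = (X - C (I * (d 0 : ℂ))) * (X - C (I * (d 1 : ℂ))) * (X - C (I * (d 2 : ℂ)))) :
    Function.Injective d := by
  rw [charpoly_potential ha] at hd
  obtain ⟨hsum, hpair, hprod⟩ := eigenvalue_relations hd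
  refine injective_of_eigenvalue_relations hsum hpair hprod ?_
  have hre : ((lam : ℂ) ^ (-3 : ℤ) * ψ).re ^ 2 ≤ ‖ψ‖ ^ 2 := by
    rw [← norm_neg_I_mul_zpow_mul lam (-3) ψ, norm_mul, norm_neg, norm_I, one_mul, ← sq_abs]
    exact pow_le_pow_left₀ (abs_nonneg _) (Complex.abs_re_le_norm _) 2
  linarith [lt_betaConst_pow_three ha hβ]

theorem IsEquivariantLift.exists_isModeBasis_of_charpoly_potential (h : IsEquivariantLift F e Ψ)
    (h0 : fderiv ℝ e 0 I = 0) (hΨ : Ψ 0 = -I * ((lam : ℂ) ^ (-3 : ℤ) * ψ))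
    (hβ : betaConst (e 0) ψ < 3 * e 0) {d : Fin 3 → ℝ}
    (hd : (potential (e 0) ψ lam).charpoly
      = (X - C (I * (d 0 : ℂ))) * (X - C (I * (d 1 : ℂ))) * (X - C (I * (d 2 : ℂ)))) :
    ∃ L, IsModeBasis F d L := by
  refine h.exists_isModeBasis (injective_of_charpoly_potential (h.pos 0) hβ hd) fun j => ?_
  rw [h.charpoly_generator_eq_charpoly_potential h0 hΨ, hd]
  fin_cases j <;> simp

section Closing

variable {d : Fin 3 → ℝ} {L : Fin 3 → (Fin 3 → ℂ) →L[ℂ] ℂ}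

theorem IsModeBasis.exists_real_cylinder_iff (hL : IsModeBasis F d L) (h : IsMinimalLift F e Ψ)
    (hl : IsLift F f) (hsum : ∑ j, d j = 0) (hd : d 1 ≠ 0) :
    (∃ p : ℝ, IsCylinderRel f p) ↔ ∃ q : ℚ, d 0 / d 1 = q := by
  rw [← exists_real_period_iff hsum hd]
  refine exists_congr fun p => ?_
  rw [IsCylinderRel, ofReal_ne_zero, hL.translation_closes_iff h hl
    (ν := fun j => exp (I * d j * p)) fun j z => by
      rw [add_comm]
      exact (hL.isMode j).apply_translate h.differentiable p z]

theorem IsMode.norm_multiplier_eq_one {d : ℝ} {L : (Fin 3 → ℂ) →L[ℂ] ℂ} (hL : IsMode F d L)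
    (h : IsMinimalLift F e Ψ) (hL0 : L ≠ 0) {P : ℝ} {ν : ℂ}
    (hν : ∀ y : ℝ, L (F ((y + P : ℝ) * I)) = ν * L (F (y * I))) : ‖ν‖ = 1 := by
  obtain ⟨y, hy⟩ := hL.exists_apply_ne_zero h hL0
  exact MinLag.norm_multiplier_eq_one (h.norm_clm_apply_le L)
    (hL.apply_add_imag h.differentiable hν) hy

theorem IsModeBasis.exists_imag_cylinder_iff (hL : IsModeBasis F d L) (h : IsMinimalLift F e Ψ)
    (hl : IsLift F f) {T : ℝ} (hT : T ≠ 0) {ν : Fin 3 → ℂ}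
    (hν : ∀ j (y : ℝ), L j (F ((y + 2 * T : ℝ) * I)) = ν j * L j (F (y * I))) :
    (∃ m : ℤ, IsCylinderRel f (m * (2 * T) * I)) ↔ ∃ m : ℤ, m ≠ 0 ∧ ∀ j k, ν j ^ m = ν k ^ m := by
  refine exists_congr fun m => and_congr (by simp [hT]) ?_
  refine hL.translation_closes_iff h hl fun j z => ?_
  have hν0 : ν j ≠ 0 := norm_pos_iff.1 <|
    one_pos.trans_eq ((hL.isMode j).norm_multiplier_eq_one h (hL.ne_zero j) (hν j)).symm
  have hzsmul := apply_add_zsmul (G := fun z => L j (F z)) hν0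
    ((hL.isMode j).apply_add_imag h.differentiable (hν j)) m z
  rwa [zsmul_eq_mul, ofReal_mul, ofReal_ofNat, ← mul_assoc] at hzsmul

end Closing

variable {u : ℂ → ℝ} {β P : ℝ}

section Multiplier

variable {d : ℝ} {L : (Fin 3 → ℂ) →L[ℂ] ℂ}

theorem IsMode.apply_add_period_of_im_ne_zero (hL : IsMode F d L) (hL0 : L ≠ 0)
    (h : IsEquivariantLift F (fun z => Real.exp (u z)) Ψ)
    (hv : IsMetricProfile β P fun y : ℝ => u (y * I))
    (hΨ : Ψ 0 = -I * ((lam : ℂ) ^ (-3 : ℤ) * ψ)) (hp : ((lam : ℂ) ^ (-3 : ℤ) * ψ).im ≠ 0) (y : ℝ) :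
    L (F ((y + P : ℝ) * I)) =
      exp (I * (∫ s in (0 : ℝ)..P, modeRate (fun y : ℝ => u (y * I)) ψ lam d s).im)
        * L (F (y * I)) := by
  set θ := ∫ s in (0 : ℝ)..P, modeRate (fun y : ℝ => u (y * I)) ψ lam d s
  have hθ : ∀ y : ℝ, L (F ((y + P : ℝ) * I)) = exp θ * L (F (y * I)) :=
    apply_add_period_of_first_order (g := fun y : ℝ => L (F (y * I))) (hv.continuous_modeRate hp d)
      (hv.periodic_modeRate ψ lam d) fun y => by
        rw [← hL.fderiv_I_eq_modeRate_mul h hΨ (betaDen_ne_zero hp y)]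
        exact hasDerivAt_clm_imag L h.differentiable y
  have hre : θ.re = 0 := by
    have hnorm := hL.norm_multiplier_eq_one h.toIsMinimalLift hL0 hθ
    rwa [Complex.norm_exp, Real.exp_eq_one_iff] at hnorm
  rw [hθ, ← re_add_im θ, hre, ofReal_zero, zero_add, mul_comm _ I]
  simp

/-- Off the zeros of the denominator the logarithmic derivative of the mode is real, which makes the
multiplier real. -/
theorem IsMode.exists_apply_add_period_of_im_eq_zero (hL : IsMode F d L) (hL0 : L ≠ 0)
    (h : IsEquivariantLift F (fun z => Real.exp (u z)) Ψ)
    (hv : IsMetricProfile β P fun y : ℝ => u (y * I)) (hβ : β ≠ 3 * Real.exp (u 0))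
    (hΨ : Ψ 0 = -I * ((lam : ℂ) ^ (-3 : ℤ) * ψ)) (hp : ((lam : ℂ) ^ (-3 : ℤ) * ψ).im = 0) :
    ∃ ν : ℂ, ν ^ 2 = 1 ∧ ∀ y : ℝ, L (F ((y + P : ℝ) * I)) = ν * L (F (y * I)) := by
  obtain ⟨y₀, hy₀⟩ := hv.exists_deriv_ne_zero (by simpa using hβ)
  have hden : betaDen (fun y : ℝ => u (y * I)) ψ lam y₀ ≠ 0 := by
    rw [betaDen_eq, hp]
    simpa using hy₀
  have hdenP : betaDen (fun y : ℝ => u (y * I)) ψ lam (y₀ + P) ≠ 0 := by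
    rwa [hv.periodic_betaDen]
  obtain ⟨ρ, hρ⟩ := exists_ofReal_eq_modeRate (v := fun y : ℝ => u (y * I)) hp d y₀
  have hu : Continuous fun y : ℝ => u (y * I) := hv.differentiable.continuous
  obtain ⟨μ, hμ⟩ := exists_real_multiplier (P := P) (y₀ := y₀) (ρ := ρ)
    (g := fun y : ℝ => L (F (y * I)))
    (c := fun y : ℝ => d ^ 2 - 4 * Real.exp (u (y * I)))
    (continuous_const.sub (continuous_const.mul (Real.continuous_exp.comp hu)))
    (fun y => by simp only [hv.periodic y])
    (hasDerivAt_clm_imag L h.differentiable) (hL.hasDerivAt_fderiv_imag h.toIsMinimalLift)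
    (by rw [hL.fderiv_I_eq_modeRate_mul h hΨ hden, hρ])
    (by rw [hL.fderiv_I_eq_modeRate_mul h hΨ hdenP, hv.periodic_modeRate, hρ])
    (fun hg => by
      obtain ⟨y, hy⟩ := hL.exists_apply_ne_zero h.toIsMinimalLift hL0
      exact hy (congrFun hg y))
  have hnorm := hL.norm_multiplier_eq_one h.toIsMinimalLift hL0 hμ
  refine ⟨μ, ?_, hμ⟩
  rw [Complex.norm_real, Real.norm_eq_abs] at hnorm
  rw [← ofReal_pow, ← sq_abs, hnorm, one_pow, ofReal_one]

end Multiplier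

variable {d : Fin 3 → ℝ} {L : Fin 3 → (Fin 3 → ℂ) →L[ℂ] ℂ} {T : ℝ}

theorem IsModeBasis.exists_imag_cylinder_iff_of_im_ne_zero (hL : IsModeBasis F d L)
    (h : IsEquivariantLift F (fun z => Real.exp (u z)) Ψ) (hl : IsLift F f)
    (hv : IsMetricProfile β (2 * T) fun y : ℝ => u (y * I)) (hT : T ≠ 0)
    (hΨ : Ψ 0 = -I * ((lam : ℂ) ^ (-3 : ℤ) * ψ)) (hsum : d 0 + d 1 + d 2 = 0)
    (hpair : d 0 * d 1 + d 0 * d 2 + d 1 * d 2 = -β)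
    (hp : ((lam : ℂ) ^ (-3 : ℤ) * ψ).im ≠ 0) :
    (∃ m : ℤ, IsCylinderRel f (m * (2 * T) * I)) ↔
      ImagPeriodCondition β (betaOne (fun y : ℝ => u (y * I)) ψ lam (2 * T))
          (betaTwo (fun y : ℝ => u (y * I)) ψ lam (2 * T)) (d 0) ∧
        ImagPeriodCondition β (betaOne (fun y : ℝ => u (y * I)) ψ lam (2 * T))
          (betaTwo (fun y : ℝ => u (y * I)) ψ lam (2 * T)) (d 1) := by
  rw [hL.exists_imag_cylinder_iff h.toIsMinimalLift hl hT fun j =>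
    (hL.isMode j).apply_add_period_of_im_ne_zero (hL.ne_zero j) h hv hΨ hp]
  have hphase := hv.im_integral_modeRate hp
  unfold ImagPeriodCondition
  generalize (betaOne (fun y : ℝ => u (y * I)) ψ lam (2 * T)).re = b₁ at hphase ⊢
  generalize (betaTwo (fun y : ℝ => u (y * I)) ψ lam (2 * T)).im = b₂ at hphase ⊢
  refine exists_common_multiplier_iff (θ := fun j => b₁ * d j + b₂ * (-d j ^ 2 + 2 * β / 3)) ?_ ?_
  · have hsq : d 0 ^ 2 + d 1 ^ 2 + d 2 ^ 2 = 2 * β := by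
      linear_combination (d 0 + d 1 + d 2) * hsum - 2 * hpair
    rw [Fin.sum_univ_three]
    linear_combination b₁ * hsum - b₂ * hsq
  · intro j k
    rw [hphase, hphase (d k)]
    ring

theorem IsModeBasis.exists_imag_cylinder_of_im_eq_zero (hL : IsModeBasis F d L)
    (h : IsEquivariantLift F (fun z => Real.exp (u z)) Ψ) (hl : IsLift F f)
    (hv : IsMetricProfile β (2 * T) fun y : ℝ => u (y * I)) (hT : T ≠ 0)
    (hβ : β ≠ 3 * Real.exp (u 0)) (hΨ : Ψ 0 = -I * ((lam : ℂ) ^ (-3 : ℤ) * ψ))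
    (hp : ((lam : ℂ) ^ (-3 : ℤ) * ψ).im = 0) :
    ∃ m : ℤ, IsCylinderRel f (m * (2 * T) * I) := by
  choose ν hν_sq hν using fun j =>
    (hL.isMode j).exists_apply_add_period_of_im_eq_zero (hL.ne_zero j) h hv hβ hΨ hp
  refine (hL.exists_imag_cylinder_iff h.toIsMinimalLift hl hT hν).2 ⟨2, two_ne_zero, fun j k => ?_⟩
  exact_mod_cast (hν_sq j).trans (hν_sq k).symm

theorem imagPeriodCondition_ofReal_mul_I_zero (β V d : ℝ) : ImagPeriodCondition β (V * I) 0 d :=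
  ⟨0, by simp⟩

end Assembly

end MinLag

theorem mainTheorem12
    (lam0 : Circle) (u : ℂ → ℝ) (ψ : ℂ → ℂ) (f : ℂ → MinLag.CP2)
    -- `f = f(·, lam0)` is a member of an associated family, and translationally equivariant
    (hf : MinLag.IsAssociatedMember lam0 u ψ f)
    (hequiv : MinLag.IsTranslationallyEquivariant f)
    -- the cubic differential is not identically zero
    (hψ : ∃ z, ψ z ≠ 0)
    -- normalization of the origin, `∂u/∂y (0) = 0` and `a₂ < a₁`; the surface is not flat
    (hu0 : fderiv ℝ u 0 I = 0)
    (ha : MinLag.aTwo (Real.exp (u 0)) (ψ 0) < Real.exp (u 0))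
    -- `i d₁, i d₂, i d₃` are the eigenvalues of `D(lam0)`
    (d₁ d₂ d₃ : ℝ)
    (hd : (MinLag.potential (Real.exp (u 0)) (ψ 0) lam0).charpoly =
      (X - C (I * (d₁ : ℂ))) * (X - C (I * (d₂ : ℂ))) * (X - C (I * (d₃ : ℂ))))
    -- `T`, `β`, and `u` as a function of `y`
    (T β : ℝ) (v : ℝ → ℝ)
    (hT : T = MinLag.halfPeriod (Real.exp (u 0)) (ψ 0))
    (hβ : β = MinLag.betaConst (Real.exp (u 0)) (ψ 0))
    (hv : v = fun y : ℝ => u (y * I)) :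
    -- real translations
    (d₂ ≠ 0 →
      ((∃ p : ℝ, MinLag.IsCylinderRel f p) ↔ ∃ q : ℚ, d₁ / d₂ = q)) ∧
    -- purely imaginary translations, `lam0⁻³ ψ` not real
    (((lam0 : ℂ) ^ (-3 : ℤ) * ψ 0).im ≠ 0 →
      IntervalIntegrable (MinLag.betaOneIntegrand v (ψ 0) lam0) volume 0 (2 * T) ∧
      IntervalIntegrable (MinLag.betaTwoIntegrand v (ψ 0) lam0) volume 0 (2 * T) ∧
      ((∃ m : ℤ, MinLag.IsCylinderRel f (m * (2 * T) * I)) ↔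
        MinLag.ImagPeriodCondition β (MinLag.betaOne v (ψ 0) lam0 (2 * T))
            (MinLag.betaTwo v (ψ 0) lam0 (2 * T)) d₁ ∧
        MinLag.ImagPeriodCondition β (MinLag.betaOne v (ψ 0) lam0 (2 * T))
            (MinLag.betaTwo v (ψ 0) lam0 (2 * T)) d₂)) ∧
    -- purely imaginary translations, `lam0⁻³ ψ` real: the integrals are principal values
    (((lam0 : ℂ) ^ (-3 : ℤ) * ψ 0).im = 0 →
      ∃ B₁ B₂ : ℂ,
        MinLag.HasPrincipalValue (MinLag.betaOneIntegrand v (ψ 0) lam0)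
          (MinLag.betaDen v (ψ 0) lam0) (2 * T) B₁ ∧
        MinLag.HasPrincipalValue (MinLag.betaTwoIntegrand v (ψ 0) lam0)
          (MinLag.betaDen v (ψ 0) lam0) (2 * T) B₂ ∧
        ((∃ m : ℤ, MinLag.IsCylinderRel f (m * (2 * T) * I)) ↔
          MinLag.ImagPeriodCondition β B₁ B₂ d₁ ∧ MinLag.ImagPeriodCondition β B₁ B₂ d₂)) := by
  subst hT hβ hv
  obtain ⟨F, h, hl⟩ := MinLag.exists_equivariantLift hf hequiv
  have hψ0 : ψ 0 ≠ 0 := by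
    obtain ⟨z, hz⟩ := hψ
    rwa [mul_left_cancel₀ (mul_ne_zero (neg_ne_zero.2 I_ne_zero)
      (zpow_ne_zero (-3) (Circle.coe_ne_zero lam0))) (h.hopf_const z)] at hz
  have hΨ : -I * (lam0 : ℂ) ^ (-3 : ℤ) * ψ 0 = -I * ((lam0 : ℂ) ^ (-3 : ℤ) * ψ 0) := mul_assoc _ _ _
  have hβ := MinLag.betaConst_lt_of_aTwo_lt (Real.exp_pos _) ha
  have hT := (MinLag.halfPeriod_pos (Real.exp_pos (u 0)) hψ0).ne'
  have hv := h.isMetricProfile hψ0 (by rw [hΨ, MinLag.norm_neg_I_mul_zpow_mul]) hu0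
  obtain ⟨L, hL⟩ := h.exists_isModeBasis_of_charpoly_potential (d := ![d₁, d₂, d₃])
    (by rw [h.fderiv_exp_conformalFactor, hu0, mul_zero]) hΨ hβ hd
  rw [MinLag.charpoly_potential (Real.exp_pos _)] at hd
  obtain ⟨hsum, hpair, -⟩ := MinLag.eigenvalue_relations hd
  refine ⟨hL.exists_real_cylinder_iff h.toIsMinimalLift hl (by simpa [Fin.sum_univ_three]),
    fun hp => ⟨(hv.continuous_betaOneIntegrand hp).intervalIntegrable _ _,
      (hv.continuous_betaTwoIntegrand hp).intervalIntegrable _ _,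
      hL.exists_imag_cylinder_iff_of_im_ne_zero h hl hv hT hΨ hsum hpair hp⟩, fun hp => ?_⟩
  obtain ⟨V, hV⟩ := hv.exists_hasPrincipalValue_betaOne hp
  exact ⟨V * I, 0, hV, hv.hasPrincipalValue_betaTwo hp,
    iff_of_true (hL.exists_imag_cylinder_of_im_eq_zero h hl hv hT hβ.ne hΨ hp)
      ⟨MinLag.imagPeriodCondition_ofReal_mul_I_zero _ V d₁,
        MinLag.imagPeriodCondition_ofReal_mul_I_zero _ V d₂⟩⟩
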